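/- Let $L$ be a finite lattice that is semimodular ($x\preceq y$ implies $x\vee z\preceq y\vee z$) and slim (the poset of join-irreducible elements of $L$ has no $3$-element antichain). Then $L$ has a planar Hasse diagram. Moreover, fix any planar Hasse diagram of $L$ (with straight line segments as edges) and let $\mathfrak p$ and $\mathfrak q$ be prime intervals of $L$, where a prime interval $\mathfrak r=[0_{\mathfrak r},1_{\mathfrak r}]$ is an interval with $0_{\mathfrak r}\prec 1_{\mathfrak r}$. Let $\operatorname{con}(\mathfrak p)$ be the least congruence of $L$ collapsing $0_{\mathfrak p}$ and $1_{\mathfrak p}$. Then $(0_{\mathfrak q},1_{\mathfrak q})\in\operatorname{con}(\mathfrak p)$ if and only if there is an SS-sequence from $\mathfrak p$ to $\mathfrak q$, that is, a sequence $\mathfrak r_0=\mathfrak p,\mathfrak r_1,\dots,\mathfrak r_n=\mathfrak q$ ($n\ge 0$) of prime intervals such that for each $i\in\{1,\dots,n\}$, $\mathfrak r_{i-1}$ is cell-perspective to $\mathfrak r_i$ or swings to $\mathfrak r_i$. Here a region consists of the elements of an interval $[a,b]$ (where $a<b$ and $a\nprec b$) that are on the right of $C_1$ and on the left of $C_2$,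 where $C_1$ and $C_2$ are maximal chains of $[a,b]$ with $C_1\cap C_2=\{a,b\}$ and $C_2\setminus\{a,b\}$ on the right of $C_1$ (elements of a chain count as being on both sides of it). A cell is a minimal region, and a $4$-cell is a cell with four vertices and four edges. For distinct prime intervals $\mathfrak r,\mathfrak s$ belonging to the same $4$-cell, $\mathfrak r$ is cell-perspective to $\mathfrak s$ if they are opposite sides of this $4$-cell, and $\mathfrak r$ swings to $\mathfrak s$ if $1_{\mathfrak r}=1_{\mathfrak s}$, the element $1_{\mathfrak r}$ has at least three lower covers, and $0_{\mathfrak s}$ is neither the leftmost nor the rightmost lower cover of $1_{\mathfrak r}$. -/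

import Mathlib

namespace SwingLemma

/-- A lattice is slim if its poset of join-irreducible elements has no 3-element antichain.
(Slim lattices are finite by convention; finiteness is a separate hypothesis.) -/
def IsSlim (L : Type*) [Lattice L] : Prop :=
  ¬ ∃ s : Finset L, s.card = 3 ∧ (∀ x ∈ s, SupIrred x) ∧ IsAntichain (· ≤ ·) (s : Set L)

/-- A prime interval (edge) `[lo, hi]`, where `lo` is covered by `hi`. -/
@[ext]
structure PrimeInterval (L : Type*) [Lattice L] where
  lo : L
  hi : L
  covBy : lo ⋖ hi

/-- The least lattice congruence collapsing `a` and `b`: the intersection of all lattice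
congruences collapsing them. -/
def con {L : Type*} [Lattice L] (a b : L) : LatticeCon L where
  r x y := ∀ θ : LatticeCon L, θ.r a b → θ.r x y
  iseqv :=
    { refl := fun x θ _ => θ.iseqv.refl x
      symm := fun h θ hθ => θ.iseqv.symm (h θ hθ)
      trans := fun h h' θ hθ => θ.iseqv.trans (h θ hθ) (h' θ hθ) }
  inf h h' := fun θ hθ => θ.inf (h θ hθ) (h' θ hθ)
  sup h h' := fun θ hθ => θ.sup (h θ hθ) (h' θ hθ)

/-- A planar Hasse diagram: the elements are distinct points of the plane, larger elements are
higher, each covering pair is joined by a straight line segment, an edge passes through no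
vertex other than its two endpoints, and two distinct edges meet only in a common endpoint. -/
structure PlanarDiagram (L : Type*) [Lattice L] where
  pos : L → ℝ × ℝ
  pos_injective : Function.Injective pos
  height_lt : ∀ ⦃a b : L⦄, a < b → (pos a).2 < (pos b).2
  vertex_edge : ∀ ⦃a b v : L⦄, a ⋖ b → pos v ∈ segment ℝ (pos a) (pos b) → v = a ∨ v = b
  edge_edge : ∀ ⦃a b c d : L⦄, a ⋖ b → c ⋖ d → (a, b) ≠ (c, d) →
    segment ℝ (pos a) (pos b) ∩ segment ℝ (pos c) (pos d) ⊆ pos '' ({a, b} ∩ {c, d})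

namespace PlanarDiagram

variable {L : Type*} [Lattice L] (D : PlanarDiagram L)

/-- `x` is on the left of the chain `C` (or on `C`): at the height of `x`, the polygonal line
formed by the edges of `C` has a point whose first coordinate is at least that of `x`. -/
def LeftOfChain (C : Set L) (x : L) : Prop :=
  ∃ u ∈ C, ∃ v ∈ C, u ⋖ v ∧ ∃ t ∈ segment ℝ (D.pos u) (D.pos v),
    t.2 = (D.pos x).2 ∧ (D.pos x).1 ≤ t.1

/-- `x` is on the right of the chain `C` (or on `C`). -/
def RightOfChain (C : Set L) (x : L) : Prop :=
  ∃ u ∈ C, ∃ v ∈ C, u ⋖ v ∧ ∃ t ∈ segment ℝ (D.pos u) (D.pos v),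
    t.2 = (D.pos x).2 ∧ t.1 ≤ (D.pos x).1

/-- `C` is a maximal chain in the interval `[a, b]`. -/
def IsMaxChainIn (a b : L) (C : Set L) : Prop :=
  Maximal (fun E : Set L => E ⊆ Set.Icc a b ∧ IsChain (· ≤ ·) E) C

/-- `R` is a region: for some `a < b` with `b` not covering `a`, it consists of the elements of
`[a, b]` between two maximal chains `C₁` and `C₂` of `[a, b]` that meet only in `a` and `b`,
with `C₂` on the right of `C₁`. -/
def IsRegion (R : Set L) : Prop :=
  ∃ (a b : L) (C₁ C₂ : Set L), a < b ∧ ¬ a ⋖ b ∧ IsMaxChainIn a b C₁ ∧ IsMaxChainIn a b C₂ ∧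
    C₁ ∩ C₂ = {a, b} ∧ (∀ x ∈ C₂ \ {a, b}, D.RightOfChain C₁ x) ∧
    R = {x | x ∈ Set.Icc a b ∧ D.RightOfChain C₁ x ∧ D.LeftOfChain C₂ x}

/-- A cell is a minimal region. -/
def IsCell (S : Set L) : Prop :=
  Minimal D.IsRegion S

/-- A 4-cell is a cell with four vertices. (As both bounding chains of a region have an inner
element, such a cell has one inner element on each side, and hence four edges.) -/
def IsFourCell (S : Set L) : Prop :=
  D.IsCell S ∧ S.ncard = 4

/-- The horizontal displacement per unit of descent along the edge from `z` down to its lower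
cover `a`; the lower covers of `z` are listed from left to right as this number increases. -/
noncomputable def descentSlope (z a : L) : ℝ :=
  ((D.pos a).1 - (D.pos z).1) / ((D.pos z).2 - (D.pos a).2)

/-- `a` is the leftmost lower cover of `z`. -/
def IsLeftmostLowerCover (z a : L) : Prop :=
  a ⋖ z ∧ ∀ a', a' ⋖ z → D.descentSlope z a ≤ D.descentSlope z a'

/-- `a` is the rightmost lower cover of `z`. -/
def IsRightmostLowerCover (z a : L) : Prop :=
  a ⋖ z ∧ ∀ a', a' ⋖ z → D.descentSlope z a' ≤ D.descentSlope z a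

/-- The prime interval `r` is an edge of the set `S` of elements (used for 4-cells `S`). -/
def EdgeOf (r : PrimeInterval L) (S : Set L) : Prop :=
  r.lo ∈ S ∧ r.hi ∈ S

/-- `r` is cell-perspective to `s`: they are opposite sides of some 4-cell, that is, two sides
without a common endpoint. -/
def CellPerspective (r s : PrimeInterval L) : Prop :=
  ∃ S : Set L, D.IsFourCell S ∧ EdgeOf r S ∧ EdgeOf s S ∧
    Disjoint ({r.lo, r.hi} : Set L) {s.lo, s.hi}

/-- `r` swings to `s`: they are distinct edges of the same 4-cell with a common top, this top has
at least three lower covers, and the bottom of `s` is neither the leftmost nor the rightmost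
lower cover of it. -/
def Swings (r s : PrimeInterval L) : Prop :=
  r ≠ s ∧ (∃ S : Set L, D.IsFourCell S ∧ EdgeOf r S ∧ EdgeOf s S) ∧
    r.hi = s.hi ∧ 3 ≤ {x : L | x ⋖ r.hi}.ncard ∧
    ¬ D.IsLeftmostLowerCover r.hi s.lo ∧ ¬ D.IsRightmostLowerCover r.hi s.lo

/-- The sequence `r 0, …, r n` of prime intervals is an SS-sequence: each member is
cell-perspective to or swings to the next one. -/
def IsSSSequence {n : ℕ} (r : Fin (n + 1) → PrimeInterval L) : Prop :=
  ∀ i : Fin n, D.CellPerspective (r i.castSucc) (r i.succ) ∨ D.Swings (r i.castSucc) (r i.succ)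

end PlanarDiagram

end SwingLemma

/-!
Planarity. By Dilworth's theorem the join-irreducible elements split into two chains. Counting the
join-irreducible elements of each chain below `x` embeds `L` into `ℝ²`, and this dominance drawing,
turned by 45 degrees, is planar.

Congruences. Let `E` be the set of edges reached from `p` by SS-sequences. Every element has at most
two upper covers, and by semimodularity these span a covering square, which is a 4-cell; hence the
relation that some maximal chain of `[x ⊓ y, x ⊔ y]` has all its edges in `E` is compatible with
joins.
For meets, neighbouring lower covers of an element bound a 4-cell, and by planarity a lower cover
lying between two others contains their meet, so swings and perspectivities carry the edges of `E`
down along any two lower covers. The relation is thus a congruence collapsing `p`. Conversely,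
each cell-perspectivity and each swing takes a collapsed edge to a collapsed edge.
-/

namespace SwingLemma

section Dilworth

variable {α : Type*} [PartialOrder α] {S T : Finset α} {k : ℕ} {C : α → ℕ}

/-- A partition of `S` into `k` chains, encoded as a colouring with colours `0, …, k - 1` in which
elements of the same colour are comparable. -/
structure IsChainColoring (S : Finset α) (k : ℕ) (C : α → ℕ) : Prop where
  lt : ∀ x ∈ S, C x < k
  total : ∀ x ∈ S, ∀ y ∈ S, C x = C y → x ≤ y ∨ y ≤ x

theorem IsChainColoring.exists_mem_eq (hC : IsChainColoring S k C) {A : Finset α} (hAS : A ⊆ S)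
    (hA : IsAntichain (· ≤ ·) (A : Set α)) (hcard : A.card = k) {i : ℕ} (hi : i < k) :
    ∃ y ∈ A, C y = i := by
  have hinj : Set.InjOn C A := fun x hx y hy hxy =>
    (hC.total x (hAS hx) y (hAS hy) hxy).elim (hA.eq hx hy) (hA.eq' hx hy)
  have himage : A.image C = Finset.range k :=
    Finset.eq_of_subset_of_card_le
      (Finset.image_subset_iff.2 fun x hx => Finset.mem_range.2 (hC.lt x (hAS hx)))
      (by rw [Finset.card_range, Finset.card_image_of_injOn hinj, hcard])
  exact Finset.mem_image.1 (himage ▸ Finset.mem_range.2 hi)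

theorem IsChainColoring.exists_succ [DecidableEq α] (hC : IsChainColoring T k C)
    (hST : IsChain (· ≤ ·) ((S \ T : Finset α) : Set α)) : ∃ C', IsChainColoring S (k + 1) C' := by
  have hmem {x : α} (hx : x ∈ S) (hxT : x ∉ T) : x ∈ ((S \ T : Finset α) : Set α) :=
    Finset.mem_coe.2 (Finset.mem_sdiff.2 ⟨hx, hxT⟩)
  refine ⟨fun x => if x ∈ T then C x else k, fun x _ => ?_, fun x hx y hy hxy => ?_⟩
  · have := hC.lt x
    grind
  · by_cases hxT : x ∈ T <;> by_cases hyT : y ∈ T <;> simp only [hxT, hyT, if_true, if_false] at hxy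
    · exact hC.total x hxT y hyT hxy
    · exact absurd hxy (hC.lt x hxT).ne
    · exact absurd hxy (hC.lt y hyT).ne'
    · exact hST.total (hmem hx hxT) (hmem hy hyT)

/-- `x` belongs to an antichain of size `k` in `S`. -/
def InAntichain (S : Finset α) (k : ℕ) (x : α) : Prop :=
  ∃ A ⊆ S, IsAntichain (· ≤ ·) (A : Set α) ∧ A.card = k ∧ x ∈ A

theorem IsChainColoring.exists_isGreatest (hC : IsChainColoring S k C) {A : Finset α} (hAS : A ⊆ S)
    (hA : IsAntichain (· ≤ ·) (A : Set α)) (hcard : A.card = k) {i : ℕ} (hi : i < k) :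
    ∃ x, IsGreatest {x | InAntichain S k x ∧ C x = i} x := by
  obtain ⟨y, hyA, hyi⟩ := hC.exists_mem_eq hAS hA hcard hi
  have hsub : {x | InAntichain S k x ∧ C x = i} ⊆ S := fun x hx => by
    obtain ⟨⟨A, hAS, -, -, hxA⟩, -⟩ := hx
    exact hAS hxA
  obtain ⟨x, hx⟩ := (S.finite_toSet.subset hsub).exists_maximal ⟨y, ⟨A, hAS, hA, hcard, hyA⟩, hyi⟩
  refine ⟨x, hx.1, fun z hz => ?_⟩
  exact (hC.total z (hsub hz) x (hsub hx.1) (hz.2.trans hx.1.2.symm)).elim id (hx.2 hz)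

theorem IsChainColoring.exists_max_antichain (hC : IsChainColoring S k C) {A : Finset α}
    (hAS : A ⊆ S) (hA : IsAntichain (· ≤ ·) (A : Set α)) (hcard : A.card = k) :
    ∃ X ⊆ S, IsAntichain (· ≤ ·) (X : Set α) ∧ X.card = k ∧
      ∀ x ∈ X, ∀ z, InAntichain S k z → C z = C x → z ≤ x := by
  classical
  choose x hx using fun i : Fin k => hC.exists_isGreatest hAS hA hcard i.isLt
  have hcolor (i : Fin k) : C (x i) = i := (hx i).1.2
  have heq {i j : Fin k} (hij : x i ≤ x j) : i = j := by
    obtain ⟨B, hBS, hB, hBcard, hjB⟩ := (hx j).1.1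
    obtain ⟨y, hyB, hyi⟩ := hC.exists_mem_eq hBS hB hBcard i.isLt
    have hyx : y ≤ x i := (hx i).2 ⟨⟨B, hBS, hB, hBcard, hyB⟩, hyi⟩
    rw [Fin.ext_iff, ← hyi, hB.eq hyB hjB (hyx.trans hij), hcolor]
  refine ⟨Finset.univ.image x, ?_, ?_, ?_, ?_⟩
  · refine Finset.image_subset_iff.2 fun i _ => ?_
    obtain ⟨B, hBS, -, -, hiB⟩ := (hx i).1.1
    exact hBS hiB
  · rw [Finset.coe_image, Finset.coe_univ, Set.image_univ]
    rintro _ ⟨i, rfl⟩ _ ⟨j, rfl⟩ hne hij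
    exact hne (congrArg x (heq hij))
  · rw [Finset.card_image_of_injective _ fun i j hij => heq hij.le, Finset.card_fin]
  · simp only [Finset.mem_image, Finset.mem_univ, true_and, forall_exists_index]
    rintro _ i rfl z hz hzi
    exact (hx i).2 ⟨hz, hzi.trans (hcolor i)⟩

/-- The inductive step of Galvin's proof of Dilworth's theorem: removing the chain that consists of
`a` and of the elements below the topmost element `x ≤ a` of its colour destroys all antichains of
size `k + 1`. -/
theorem IsChainColoring.exists_chain_sdiff [DecidableEq α] {a : α} (haS : a ∈ S)
    (hmax : ∀ x ∈ S, ¬ a < x) (hC : IsChainColoring (S.erase a) (k + 1) C)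
    (hS : ∀ A ⊆ S, IsAntichain (· ≤ ·) (A : Set α) → A.card ≤ k + 1) :
    ∃ T ⊂ S, IsChain (· ≤ ·) ((S \ T : Finset α) : Set α) ∧
      ∀ A ⊆ T, IsAntichain (· ≤ ·) (A : Set α) → A.card ≤ k := by
  classical
  by_cases hsmall : ∀ A ⊆ S.erase a, IsAntichain (· ≤ ·) (A : Set α) → A.card ≤ k
  · refine ⟨S.erase a, Finset.erase_ssubset haS, ?_, hsmall⟩
    simp [Finset.sdiff_erase_self haS]
  push Not at hsmall
  obtain ⟨A, hAS, hA, hAk⟩ := hsmall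
  have hAcard : A.card = k + 1 := le_antisymm (hS A (hAS.trans (S.erase_subset a)) hA) hAk
  obtain ⟨X, hXS, hX, hXcard, hXmax⟩ := hC.exists_max_antichain hAS hA hAcard
  have haX : a ∉ X := fun h => Finset.notMem_erase a S (hXS h)
  obtain ⟨x, hxX, hxa⟩ : ∃ x ∈ X, x ≤ a := by
    by_contra! h
    have hle : (insert a X).card ≤ k + 1 := by
      refine hS _ (Finset.insert_subset haS (hXS.trans (S.erase_subset a))) ?_
      rw [Finset.coe_insert]
      refine hX.insert (fun x hx _ => h x hx) fun x hx hne hax => ?_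
      exact hmax x (Finset.mem_of_mem_erase (hXS hx)) (hax.lt_of_ne hne)
    rw [Finset.card_insert_of_notMem haX, hXcard] at hle
    omega
  refine ⟨{z ∈ S.erase a | ¬ (C z = C x ∧ z ≤ x)},
    (Finset.filter_subset _ _).trans_ssubset (Finset.erase_ssubset haS), ?_, fun B hB hBanti => ?_⟩
  · have hsdiff : ∀ z ∈ S \ {z ∈ S.erase a | ¬ (C z = C x ∧ z ≤ x)},
        z = a ∨ z ∈ S.erase a ∧ C z = C x ∧ z ≤ x := by grind
    intro y hy z hz _
    obtain rfl | ⟨hyS, hyC, hyx⟩ := hsdiff y hy <;> obtain rfl | ⟨hzS, hzC, hzx⟩ := hsdiff z hz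
    · exact .inl le_rfl
    · exact .inr (hzx.trans hxa)
    · exact .inl (hyx.trans hxa)
    · exact hC.total y hyS z hzS (hyC.trans hzC.symm)
  · have hBS : B ⊆ S.erase a := hB.trans (Finset.filter_subset _ _)
    by_contra! hk
    have hBcard : B.card = k + 1 := le_antisymm (hS B (hBS.trans (S.erase_subset a)) hBanti) hk
    obtain ⟨z, hzB, hzx⟩ := hC.exists_mem_eq hBS hBanti hBcard (hC.lt x (hXS hxX))
    have hz : z ≤ x := hXmax x hxX z ⟨B, hBS, hBanti, hBcard, hzB⟩ hzx
    exact (Finset.mem_filter.1 (hB hzB)).2 ⟨hzx, hz⟩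

/-- Dilworth's theorem. -/
theorem exists_isChainColoring (S : Finset α) (k : ℕ)
    (hS : ∀ A ⊆ S, IsAntichain (· ≤ ·) (A : Set α) → A.card ≤ k) :
    ∃ C, IsChainColoring S k C := by
  classical
  induction S using Finset.strongInduction generalizing k with
  | H S ih =>
  obtain rfl | hne := S.eq_empty_or_nonempty
  · exact ⟨fun _ => 0, by simp, by simp⟩
  obtain ⟨a, ha⟩ := S.exists_maximal hne
  obtain ⟨k, rfl⟩ : ∃ m, k = m + 1 := by
    have := hS {a} (by simpa using ha.1) (by simp)
    exact ⟨k - 1, by grind⟩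
  obtain ⟨C, hC⟩ := ih (S.erase a) (Finset.erase_ssubset ha.1) (k + 1)
    fun A hA => hS A (hA.trans (S.erase_subset a))
  obtain ⟨T, hTS, hST, hT⟩ := hC.exists_chain_sdiff ha.1 (fun x hx => ha.not_gt hx) hS
  obtain ⟨C', hC'⟩ := ih T hTS k hT
  exact hC'.exists_succ hST

end Dilworth

section OrderDimension

theorem le_of_ncard_le {α : Type*} [PartialOrder α] [Finite α] {A : Set α}
    (hA : IsChain (· ≤ ·) A) {x y : α} (h : {j ∈ A | j ≤ x}.ncard ≤ {j ∈ A | j ≤ y}.ncard)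
    {j : α} (hj : j ∈ A) (hjx : j ≤ x) : j ≤ y := by
  by_contra hjy
  have hlt : {i ∈ A | i ≤ y} ⊂ {i ∈ A | i ≤ x} := by
    refine ⟨fun i hi => ⟨hi.1, ?_⟩, fun hsub => hjy (hsub ⟨hj, hjx⟩).2⟩
    exact (hA.total hi.1 hj).elim (·.trans hjx) fun hji => absurd (hji.trans hi.2) hjy
  exact h.not_gt (Set.ncard_lt_ncard hlt)

variable {L : Type*} [Lattice L]

theorem IsSlim.card_le_two (hslim : IsSlim L) {A : Finset L} (hirr : ∀ x ∈ A, SupIrred x)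
    (hA : IsAntichain (· ≤ ·) (A : Set L)) : A.card ≤ 2 := by
  by_contra! h
  obtain ⟨s, hsA, hs⟩ := Finset.exists_subset_card_eq (n := 3) h
  exact hslim ⟨s, hs, fun x hx => hirr x (hsA hx), hA.subset hsA⟩

variable [Finite L]

theorem exists_supIrred_le_not_le {x y : L} (h : ¬ x ≤ y) : ∃ j, SupIrred j ∧ j ≤ x ∧ ¬ j ≤ y := by
  have : Nonempty L := ⟨x⟩
  let _ : Fintype L := Fintype.ofFinite L
  let _ : OrderBot L := Fintype.toOrderBot L
  obtain ⟨s, hs, hirr⟩ := exists_supIrred_decomposition x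
  by_contra! hall
  refine h ?_
  rw [← hs, Finset.sup_le_iff]
  exact fun j hj => hall j (hirr hj) (hs ▸ Finset.le_sup (f := id) hj)

/-- The `i`-th coordinate of `x` counts the join-irreducible elements of colour `i` below `x`. -/
theorem nonempty_orderEmbedding_of_supIrred {k : ℕ}
    (h : ∀ A : Finset L, (∀ x ∈ A, SupIrred x) → IsAntichain (· ≤ ·) (A : Set L) → A.card ≤ k) :
    Nonempty (L ↪o (Fin k → ℝ)) := by
  obtain ⟨C, hC⟩ := exists_isChainColoring (Set.toFinite {x : L | SupIrred x}).toFinset k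
    fun A hA => h A fun x hx => by simpa using hA hx
  let J (i : ℕ) : Set L := {j | SupIrred j ∧ C j = i}
  have hJ (i : ℕ) : IsChain (· ≤ ·) (J i) := fun x hx y hy _ =>
    hC.total x (by simpa using hx.1) y (by simpa using hy.1) (hx.2.trans hy.2.symm)
  refine ⟨.ofMapLEIff (fun x i => ({j ∈ J i | j ≤ x}.ncard : ℝ)) fun x y => ⟨fun hxy => ?_, ?_⟩⟩
  · by_contra hnot
    obtain ⟨j, hj, hjx, hjy⟩ := exists_supIrred_le_not_le hnot
    have hlt : C j < k := hC.lt j (by simpa using hj)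
    exact hjy (le_of_ncard_le (hJ (C j)) (Nat.cast_le.1 (hxy ⟨C j, hlt⟩)) ⟨hj, rfl⟩ hjx)
  · exact fun hxy i => Nat.cast_le.2 (Set.ncard_le_ncard fun j hj => ⟨hj.1, hj.2.trans hxy⟩)

end OrderDimension

section DominanceDrawing

theorem mem_segment_or_mem_segment {E : Type*} [AddCommGroup E] [Module ℝ E] {o u v p : E}
    (hpo : p ≠ o) (hu : p ∈ segment ℝ o u) (hv : p ∈ segment ℝ o v) :
    u ∈ segment ℝ o v ∨ v ∈ segment ℝ o u := by
  rw [mem_segment_iff_wbtw] at hu hv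
  have hray : SameRay ℝ (u -ᵥ o) (v -ᵥ o) :=
    hu.sameRay_vsub_left.symm.trans hv.sameRay_vsub_left
      fun h => absurd (vsub_eq_zero_iff_eq.1 h) hpo
  simpa only [mem_segment_iff_wbtw] using wbtw_total_of_sameRay_vsub_left hray

/-- The linear map turning the plane by 45 degrees (up to scaling), so that the order of `ℝ²` points
upwards. -/
def turn : (Fin 2 → ℝ) →ₗ[ℝ] ℝ × ℝ where
  toFun p := (p 1 - p 0, p 0 + p 1)
  map_add' p q := by ext <;> simp only [Pi.add_apply, Prod.mk_add_mk] <;> ring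
  map_smul' r p := by ext <;> simp only [Pi.smul_apply, Prod.smul_mk, smul_eq_mul,
    RingHom.id_apply] <;> ring

theorem turn_injective : Function.Injective turn := by
  intro p q h
  have h₁ : p 1 - p 0 = q 1 - q 0 := congrArg Prod.fst h
  have h₂ : p 0 + p 1 = q 0 + q 1 := congrArg Prod.snd h
  ext i
  fin_cases i <;> simp only [Fin.zero_eta, Fin.mk_one] <;> linarith

theorem turn_snd_lt {p q : Fin 2 → ℝ} (h : p < q) : (turn p).2 < (turn q).2 := by
  obtain ⟨hle, i, hi⟩ := Pi.lt_def.1 h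
  have h₀ := hle 0
  have h₁ := hle 1
  change p 0 + p 1 < q 0 + q 1
  fin_cases i <;> simp only [Fin.zero_eta, Fin.mk_one] at hi <;> linarith

theorem image_turn_segment (a b : Fin 2 → ℝ) :
    turn '' segment ℝ a b = segment ℝ (turn a) (turn b) :=
  image_segment ℝ turn.toAffineMap a b

variable {L : Type*} [Lattice L] {E : Type*} [AddCommGroup E] [PartialOrder E]
  [IsOrderedAddMonoid E] [Module ℝ E] [PosSMulMono ℝ E] (e : L ↪o E)
  {a b c d v : L} {p : E}

theorem mem_Icc_of_mem_segment (hab : a ≤ b) (hp : p ∈ segment ℝ (e a) (e b)) :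
    e a ≤ p ∧ p ≤ e b :=
  segment_subset_Icc (e.le_iff_le.2 hab) hp

theorem eq_or_eq_of_mem_segment (hab : a ⋖ b) (hv : e v ∈ segment ℝ (e a) (e b)) :
    v = a ∨ v = b := by
  obtain ⟨hav, hvb⟩ := mem_Icc_of_mem_segment e hab.le hv
  exact hab.eq_or_eq (e.le_iff_le.1 hav) (e.le_iff_le.1 hvb)

theorem eq_of_mem_segment_of_mem_segment_left (hab : a ⋖ b) (hac : a ⋖ c) (hbc : b ≠ c)
    (hb : p ∈ segment ℝ (e a) (e b)) (hc : p ∈ segment ℝ (e a) (e c)) : p = e a := by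
  by_contra hpa
  obtain h | h := mem_segment_or_mem_segment hpa hb hc
  · exact (eq_or_eq_of_mem_segment e hac h).elim hab.ne' hbc
  · exact (eq_or_eq_of_mem_segment e hab h).elim hac.ne' hbc.symm

theorem eq_of_mem_segment_of_mem_segment_right (hac : a ⋖ c) (hbc : b ⋖ c) (hab : a ≠ b)
    (ha : p ∈ segment ℝ (e a) (e c)) (hb : p ∈ segment ℝ (e b) (e c)) : p = e c := by
  rw [segment_symm] at ha hb
  by_contra hpc
  obtain h | h := mem_segment_or_mem_segment hpc ha hb <;> rw [segment_symm] at h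
  · exact (eq_or_eq_of_mem_segment e hbc h).elim hab hac.ne
  · exact (eq_or_eq_of_mem_segment e hac h).elim hab.symm hbc.ne

/-- If `p` lies on the two edges then `a ⊔ c ≤ b ⊓ d`, which forces a common endpoint. -/
theorem segment_inter_segment_subset (hab : a ⋖ b) (hcd : c ⋖ d) (hne : (a, b) ≠ (c, d)) :
    segment ℝ (e a) (e b) ∩ segment ℝ (e c) (e d) ⊆ e '' ({a, b} ∩ {c, d}) := by
  rintro p ⟨hp, hp'⟩
  obtain ⟨hap, hpb⟩ := mem_Icc_of_mem_segment e hab.le hp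
  obtain ⟨hcp, hpd⟩ := mem_Icc_of_mem_segment e hcd.le hp'
  have had : a ≤ d := e.le_iff_le.1 (hap.trans hpd)
  have hcb : c ≤ b := e.le_iff_le.1 (hcp.trans hpb)
  obtain rfl | hda := eq_or_ne d a
  · exact ⟨d, by simp, le_antisymm hap hpd⟩
  obtain rfl | hbc := eq_or_ne b c
  · exact ⟨b, by simp, le_antisymm hcp hpb⟩
  obtain rfl | hac := eq_or_ne a c
  · have hbd : b ≠ d := fun h => hne (by rw [h])
    exact ⟨a, by simp, (eq_of_mem_segment_of_mem_segment_left e hab hcd hbd hp hp').symm⟩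
  obtain rfl | hbd := eq_or_ne b d
  · exact ⟨b, by simp, (eq_of_mem_segment_of_mem_segment_right e hab hcd hac hp hp').symm⟩
  have h₁ := hab.eq_or_eq le_sup_left (sup_le hab.le hcb)
  have h₂ := hcd.eq_or_eq le_sup_right (sup_le had hcd.le)
  grind

/-- The dominance drawing of a lattice embedded in `ℝ²`, turned by 45 degrees. -/
def PlanarDiagram.ofOrderEmbedding (e : L ↪o (Fin 2 → ℝ)) : PlanarDiagram L where
  pos x := turn (e x)
  pos_injective := turn_injective.comp e.injective
  height_lt _ _ h := turn_snd_lt (e.lt_iff_lt.2 h)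
  vertex_edge _ _ _ hab hv := by
    rw [← image_turn_segment, turn_injective.mem_set_image] at hv
    exact eq_or_eq_of_mem_segment e hab hv
  edge_edge a b c d hab hcd hne := by
    rw [← image_turn_segment, ← image_turn_segment, ← Set.image_inter turn_injective,
      ← Set.image_image turn e]
    exact Set.image_mono (segment_inter_segment_subset e hab hcd hne)

theorem IsSlim.nonempty_planarDiagram [Finite L] (hslim : IsSlim L) :
    Nonempty (PlanarDiagram L) :=
  (nonempty_orderEmbedding_of_supIrred fun _ => hslim.card_le_two).map .ofOrderEmbedding

end DominanceDrawing

section Step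

variable {L : Type*} [Lattice L] {C : Set L} {x y z : L}

/-- The covering relation of `L` restricted to `C`. When `C` is a chain, its pairs are the edges of
the polygonal line drawn by `C`. -/
def Step (C : Set L) (x y : L) : Prop :=
  x ∈ C ∧ y ∈ C ∧ x ⋖ y

theorem reflTransGen_step_of_Icc_subset [Finite L] (hxy : x ≤ y) (hC : Set.Icc x y ⊆ C) :
    Relation.ReflTransGen (Step C) x y := by
  induction x using WellFoundedGT.induction with
  | ind x ih =>
    obtain rfl | hlt := hxy.eq_or_lt
    · exact .refl
    · obtain ⟨z, hxz, hzy⟩ := exists_covBy_le_of_lt hlt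
      exact .head ⟨hC ⟨le_rfl, hxy⟩, hC ⟨hxz.le, hzy⟩, hxz⟩
        (ih z hxz.lt hzy ((Set.Icc_subset_Icc_left hxz.le).trans hC))

theorem le_of_reflTransGen_step (hxy : Relation.ReflTransGen (Step C) x y) : x ≤ y := by
  induction hxy with
  | refl => exact le_rfl
  | tail _ h ih => exact ih.trans h.2.2.le

theorem Step.le_or_le (hxy : Step C x y) (hC : IsChain (· ≤ ·) C) (hz : z ∈ C) :
    z ≤ x ∨ y ≤ z := by
  obtain h | h := hC.total hz hxy.1
  · exact .inl h
  obtain h' | h' := hC.total hz hxy.2.1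
  · exact (hxy.2.2.eq_or_eq h h').imp Eq.le Eq.ge
  · exact .inr h'

end Step

namespace PlanarDiagram

variable {L : Type*} [Lattice L] (D : PlanarDiagram L) {a b c d m u v x z : L} {p q : ℝ × ℝ}

section EdgeLine

theorem strictMono_height : StrictMono fun x => (D.pos x).2 :=
  fun _ _ h => D.height_lt h

/-- The first coordinate at height `h` of the line through the edge from `b` up to `c`. -/
noncomputable def edgeLine (b c : L) (h : ℝ) : ℝ :=
  (D.pos c).1 + D.descentSlope c b * ((D.pos c).2 - h)

theorem continuous_edgeLine (b c : L) : Continuous (D.edgeLine b c) := by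
  unfold edgeLine
  fun_prop

theorem edgeLine_height_right (b c : L) : D.edgeLine b c (D.pos c).2 = (D.pos c).1 := by
  rw [edgeLine, sub_self, mul_zero, add_zero]

theorem edgeLine_height_left (hbc : b < c) : D.edgeLine b c (D.pos b).2 = (D.pos b).1 := by
  rw [edgeLine, descentSlope, div_mul_cancel₀ _ (sub_pos.2 (D.height_lt hbc)).ne',
    add_sub_cancel]

theorem edgeLine_lt_edgeLine (hslope : D.descentSlope c a < D.descentSlope c b) {h : ℝ}
    (hh : h < (D.pos c).2) : D.edgeLine a c h < D.edgeLine b c h :=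
  add_lt_add_right (mul_lt_mul_of_pos_right hslope (sub_pos.2 hh)) _

theorem mem_segment_iff (hbc : b < c) : p ∈ segment ℝ (D.pos b) (D.pos c) ↔
    p.2 ∈ Set.Icc (D.pos b).2 (D.pos c).2 ∧ p.1 = D.edgeLine b c p.2 := by
  have hpos : 0 < (D.pos c).2 - (D.pos b).2 := sub_pos.2 (D.height_lt hbc)
  have hline (θ : ℝ) : D.edgeLine b c ((D.pos b).2 + θ * ((D.pos c).2 - (D.pos b).2)) =
      (D.pos b).1 + θ * ((D.pos c).1 - (D.pos b).1) := by
    rw [edgeLine, descentSlope]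
    field_simp
    ring
  rw [segment_eq_image']
  constructor
  · rintro ⟨θ, ⟨h₀, h₁⟩, rfl⟩
    refine ⟨⟨?_, ?_⟩, (hline θ).symm⟩ <;>
      simp only [Prod.snd_add, Prod.smul_snd, Prod.snd_sub, smul_eq_mul] <;> nlinarith
  · rintro ⟨⟨h₀, h₁⟩, hp⟩
    obtain ⟨θ, hθ⟩ : ∃ θ, p.2 = (D.pos b).2 + θ * ((D.pos c).2 - (D.pos b).2) :=
      ⟨(p.2 - (D.pos b).2) / ((D.pos c).2 - (D.pos b).2), by
        rw [div_mul_cancel₀ _ hpos.ne', add_sub_cancel]⟩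
    refine ⟨θ, ⟨by nlinarith, by nlinarith⟩, Prod.ext ?_ hθ.symm⟩
    rw [hp, hθ, hline]
    rfl

theorem eq_or_exists_common_vertex (hab : a ⋖ b) (hcd : c ⋖ d)
    (hp : p ∈ segment ℝ (D.pos a) (D.pos b)) (hp' : p ∈ segment ℝ (D.pos c) (D.pos d)) :
    (a = c ∧ b = d) ∨ ∃ v, D.pos v = p ∧ (v = a ∨ v = b) ∧ (v = c ∨ v = d) := by
  by_cases h : (a, b) = (c, d)
  · exact .inl (Prod.mk.inj h)
  · obtain ⟨v, ⟨hab, hcd⟩, hv⟩ := D.edge_edge hab hcd h ⟨hp, hp'⟩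
    exact .inr ⟨v, hv, hab, hcd⟩

theorem descentSlope_injOn (z : L) : Set.InjOn (D.descentSlope z) {a | a ⋖ z} := by
  intro a ha b hb hslope
  have hmax : max (D.pos a).2 (D.pos b).2 < (D.pos z).2 :=
    max_lt (D.height_lt ha.lt) (D.height_lt hb.lt)
  have hline : D.edgeLine a z = D.edgeLine b z := by
    ext h
    rw [edgeLine, edgeLine, hslope]
  set h := max (D.pos a).2 (D.pos b).2
  have hmem_a : (D.edgeLine a z h, h) ∈ segment ℝ (D.pos a) (D.pos z) :=
    (D.mem_segment_iff ha.lt).2 ⟨⟨le_max_left _ _, hmax.le⟩, rfl⟩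
  have hmem_b : (D.edgeLine a z h, h) ∈ segment ℝ (D.pos b) (D.pos z) :=
    (D.mem_segment_iff hb.lt).2 ⟨⟨le_max_right _ _, hmax.le⟩, congrFun hline h⟩
  obtain h | ⟨v, hv, hva, hvb⟩ := D.eq_or_exists_common_vertex ha hb hmem_a hmem_b
  · exact h.1
  · have hvz : v ≠ z := by
      rintro rfl
      exact hmax.ne' (congrArg Prod.snd hv)
    rw [← hva.resolve_right hvz, hvb.resolve_right hvz]

end EdgeLine

section Traces

/-- Over the set `S` of heights, the graph of the continuous function `f` (of the height) runs
along edges joining elements of `C`. -/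
structure Traces (C : Set L) (S : Set ℝ) (f : ℝ → ℝ) : Prop where
  continuous : Continuous f
  exists_step : ∀ h ∈ S, ∃ d e, Step C d e ∧ (f h, h) ∈ segment ℝ (D.pos d) (D.pos e)

variable {D} {C C₁ C₂ : Set L} {S T : Set ℝ} {f g : ℝ → ℝ}

theorem Traces.mono (hf : D.Traces C S f) (hTS : T ⊆ S) : D.Traces C T f :=
  ⟨hf.continuous, fun h hh => hf.exists_step h (hTS hh)⟩

theorem traces_edgeLine (hbc : Step C b c) :
    D.Traces C (Set.Icc (D.pos b).2 (D.pos c).2) (D.edgeLine b c) :=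
  ⟨D.continuous_edgeLine b c, fun _ hh => ⟨b, c, hbc, (D.mem_segment_iff hbc.2.2.lt).2 ⟨hh, rfl⟩⟩⟩

theorem Traces.piecewise {r s t : ℝ} (hf : D.Traces C (Set.Icc r s) f)
    (hg : D.Traces C (Set.Icc s t) g) (hfg : f s = g s) :
    D.Traces C (Set.Icc r t) fun h => if h ≤ s then f h else g h := by
  refine ⟨hf.continuous.if_le hg.continuous continuous_id continuous_const ?_, fun h hh => ?_⟩
  · rintro _ rfl
    exact hfg
  · by_cases hs : h ≤ s
    · simpa only [if_pos hs] using hf.exists_step h ⟨hh.1, hs⟩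
    · simpa only [if_neg hs] using hg.exists_step h ⟨(not_le.1 hs).le, hh.2⟩

theorem exists_traces (D : PlanarDiagram L) (hab : Relation.ReflTransGen (Step C) a b)
    (hbc : Step C b c) :
    ∃ f, D.Traces C (Set.Icc (D.pos a).2 (D.pos c).2) f ∧ f (D.pos a).2 = (D.pos a).1 ∧
      Set.EqOn f (D.edgeLine b c) (Set.Ici (D.pos b).2) := by
  induction hab generalizing c with
  | refl => exact ⟨D.edgeLine a c, traces_edgeLine hbc, D.edgeLine_height_left hbc.2.2.lt,
      fun _ _ => rfl⟩
  | @tail b b' hab hbb' ih =>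
    obtain ⟨f, hf, hfa, hfb⟩ := ih hbb'
    have hab' : a ≤ b' := le_of_reflTransGen_step (hab.tail hbb')
    have hjoin : f (D.pos b').2 = D.edgeLine b' c (D.pos b').2 := by
      rw [hfb (D.strictMono_height.monotone hbb'.2.2.le), D.edgeLine_height_right,
        D.edgeLine_height_left hbc.2.2.lt]
    refine ⟨_, hf.piecewise (traces_edgeLine hbc) hjoin, ?_, fun h hh => ?_⟩
    · rw [if_pos (D.strictMono_height.monotone hab'), hfa]
    · obtain rfl | hlt := eq_or_lt_of_le (show (D.pos b').2 ≤ h from hh)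
      · simp only [le_refl, if_true, hjoin]
      · exact if_neg hlt.not_ge

/-- Two polygonal lines can only cross at a common vertex or along a common edge. -/
theorem Traces.lt_of_le [S.OrdConnected] (hf : D.Traces C₁ S f) (hg : D.Traces C₂ S g)
    (hstep : ∀ d e, ¬ Step (C₁ ∩ C₂) d e) (hvertex : ∀ v ∈ C₁ ∩ C₂, (D.pos v).2 ∉ S) {s t : ℝ}
    (hs : s ∈ S) (ht : t ∈ S) (hfg : f s ≤ g s) : f t < g t := by
  by_contra! hgf
  obtain ⟨h, hh, heq⟩ := Set.OrdConnected.isPreconnected ‹_› |>.intermediate_value₂ hs ht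
    hf.continuous.continuousOn hg.continuous.continuousOn hfg hgf
  obtain ⟨d, e, hde, hp⟩ := hf.exists_step h hh
  obtain ⟨d', e', hde', hp'⟩ := hg.exists_step h hh
  rw [heq] at hp
  obtain ⟨rfl, rfl⟩ | ⟨v, hv, hvd, hvd'⟩ := D.eq_or_exists_common_vertex hde.2.2 hde'.2.2 hp hp'
  · exact hstep d e ⟨⟨hde.1, hde'.1⟩, ⟨hde.2.1, hde'.2.1⟩, hde.2.2⟩
  · have hv₁ : v ∈ C₁ := hvd.elim (· ▸ hde.1) (· ▸ hde.2.1)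
    have hv₂ : v ∈ C₂ := hvd'.elim (· ▸ hde'.1) (· ▸ hde'.2.1)
    exact hvertex v ⟨hv₁, hv₂⟩ (by rwa [hv])

theorem Traces.lt_of_le_of_inter_subset {r : ℝ} (hf : D.Traces C₁ (Set.Ico r (D.pos z).2) f)
    (hg : D.Traces C₂ (Set.Ico r (D.pos z).2) g) (hinter : C₁ ∩ C₂ ⊆ {z}) {s : ℝ}
    (hs : s ∈ Set.Ico r (D.pos z).2) (hfg : f s ≤ g s) : f r < g r := by
  refine hf.lt_of_le hg (fun d e h => ?_) (fun v hv h => ?_) hs ⟨le_rfl, hs.1.trans_lt hs.2⟩ hfg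
  · exact h.2.2.ne ((hinter h.1).trans (hinter h.2.1).symm)
  · obtain rfl := hinter hv
    exact h.2.false

theorem exists_traces_Ici [Finite L] (D : PlanarDiagram L) (hxz : x ⋖ z) (hux : u ≤ x) :
    ∃ f, D.Traces (Set.Ici u) (Set.Ico (D.pos u).2 (D.pos z).2) f ∧ f (D.pos u).2 = (D.pos u).1 ∧
      Set.EqOn f (D.edgeLine x z) (Set.Ici (D.pos x).2) := by
  obtain ⟨f, hf, hfu, hfx⟩ := D.exists_traces
    (reflTransGen_step_of_Icc_subset hux Set.Icc_subset_Ici_self) ⟨hux, hux.trans hxz.le, hxz⟩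
  exact ⟨f, hf.mono Set.Ico_subset_Icc_self, hfu, hfx⟩

theorem exists_traces_of_not_le [Finite L] (D : PlanarDiagram L) (hxz : x ⋖ z) (hux : ¬ u ≤ x) :
    ∃ C f, Set.Ici u ∩ C ⊆ {z} ∧ D.Traces C (Set.Ico (D.pos u).2 (D.pos z).2) f ∧
      Set.EqOn f (D.edgeLine x z) (Set.Ici (D.pos x).2) := by
  obtain ⟨f, hf, -, hfx⟩ := D.exists_traces (C := {v | v ≤ x ∨ v = z})
    (reflTransGen_step_of_Icc_subset (inf_le_right : u ⊓ x ≤ x) fun v hv => .inl hv.2)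
    ⟨.inl le_rfl, .inr rfl, hxz⟩
  refine ⟨_, f, fun v hv => hv.2.resolve_left fun hvx => hux (le_trans hv.1 hvx), hf.mono ?_, hfx⟩
  exact Set.Ico_subset_Icc_self.trans
    (Set.Icc_subset_Icc_left (D.strictMono_height.monotone inf_le_left))

/-- Otherwise a chain that descends from `z` through `m` to `a ⊓ b ⊓ m` would have to leave the area
enclosed by two chains that descend from `z` through `a` and `b` to `a ⊓ b`. -/
theorem inf_le_of_descentSlope_lt [Finite L] (D : PlanarDiagram L) (ha : a ⋖ z) (hm : m ⋖ z)
    (hb : b ⋖ z) (ham : D.descentSlope z a < D.descentSlope z m)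
    (hmb : D.descentSlope z m < D.descentSlope z b) : a ⊓ b ≤ m := by
  by_contra hum
  obtain ⟨f, hf, hfu, hfa⟩ := D.exists_traces_Ici ha inf_le_left
  obtain ⟨g, hg, hgu, hgb⟩ := D.exists_traces_Ici hb inf_le_right
  obtain ⟨C, k, hinter, hk, hkm⟩ := D.exists_traces_of_not_le hm hum
  obtain ⟨s, has, hms, hbs, hsz⟩ : ∃ s, (D.pos a).2 ≤ s ∧ (D.pos m).2 ≤ s ∧ (D.pos b).2 ≤ s ∧
      s < (D.pos z).2 :=
    ⟨max (D.pos a).2 (max (D.pos m).2 (D.pos b).2), by simp, by simp, by simp,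
      max_lt (D.height_lt ha.lt) (max_lt (D.height_lt hm.lt) (D.height_lt hb.lt))⟩
  have hs : s ∈ Set.Ico (D.pos (a ⊓ b)).2 (D.pos z).2 :=
    ⟨(D.strictMono_height.monotone inf_le_left).trans has, hsz⟩
  have hfk : f s < k s := by
    rw [hfa has, hkm hms]
    exact D.edgeLine_lt_edgeLine ham hsz
  have hkg : k s < g s := by
    rw [hkm hms, hgb hbs]
    exact D.edgeLine_lt_edgeLine hmb hsz
  have hfk_inf := hf.lt_of_le_of_inter_subset hk hinter hs hfk.le
  have hkg_inf := hk.lt_of_le_of_inter_subset hg (by rwa [Set.inter_comm]) hs hkg.le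
  exact (hfk_inf.trans hkg_inf).ne (hfu.trans hgu.symm)

theorem eq_pos_of_mem_segment (D : PlanarDiagram L) (hab : a < b) (hx : x ≤ a ∨ b ≤ x)
    (hp : p ∈ segment ℝ (D.pos a) (D.pos b)) (hpx : p.2 = (D.pos x).2) : p = D.pos x := by
  obtain ⟨⟨hap, hpb⟩, hp₁⟩ := (D.mem_segment_iff hab).1 hp
  rw [hpx] at hap hpb hp₁
  obtain hxa | hbx := hx
  · obtain rfl : x = a := hxa.eq_of_not_lt fun h => hap.not_gt (D.height_lt h)
    exact Prod.ext (hp₁.trans (D.edgeLine_height_left hab)) hpx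
  · obtain rfl : b = x := hbx.eq_of_not_lt fun h => hpb.not_gt (D.height_lt h)
    exact Prod.ext (hp₁.trans (D.edgeLine_height_right a b)) hpx

theorem eq_of_mem_segment_of_isChain (D : PlanarDiagram L) (hC : IsChain (· ≤ ·) C)
    (hab : Step C a b) (hcd : Step C c d) (hp : p ∈ segment ℝ (D.pos a) (D.pos b))
    (hq : q ∈ segment ℝ (D.pos c) (D.pos d)) (hpq : p.2 = q.2) : p = q := by
  have eq_of_le {a b c d : L} {p q : ℝ × ℝ} (hab : Step C a b) (hcd : Step C c d)
      (hp : p ∈ segment ℝ (D.pos a) (D.pos b)) (hq : q ∈ segment ℝ (D.pos c) (D.pos d))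
      (hpq : p.2 = q.2) (hbc : b ≤ c) : p = q := by
    have hpb := ((D.mem_segment_iff hab.2.2.lt).1 hp).1.2
    have hcq := ((D.mem_segment_iff hcd.2.2.lt).1 hq).1.1
    have hbc' := D.strictMono_height.monotone hbc
    have hpb' : p.2 = (D.pos b).2 := le_antisymm hpb (hbc'.trans (hcq.trans hpq.ge))
    rw [D.eq_pos_of_mem_segment hab.2.2.lt (.inr le_rfl) hp hpb',
      D.eq_pos_of_mem_segment hcd.2.2.lt (.inl hbc) hq (hpq.symm.trans hpb')]
  obtain hca | hbc := hab.le_or_le hC hcd.1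
  · obtain hac | hda := hcd.le_or_le hC hab.1
    · obtain rfl := le_antisymm hac hca
      have hbd : b ≤ d := (hab.le_or_le hC hcd.2.1).resolve_left hcd.2.2.lt.not_ge
      have hdb : d ≤ b := (hcd.le_or_le hC hab.2.1).resolve_left hab.2.2.lt.not_ge
      obtain rfl := le_antisymm hbd hdb
      have hp₁ := ((D.mem_segment_iff hab.2.2.lt).1 hp).2
      have hq₁ := ((D.mem_segment_iff hab.2.2.lt).1 hq).2
      exact Prod.ext (by rw [hp₁, hq₁, hpq]) hpq
    · exact (eq_of_le hcd hab hq hp hpq.symm hda).symm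
  · exact eq_of_le hab hcd hp hq hpq hbc

theorem Traces.apply_height (hf : D.Traces C S f) (hC : IsChain (· ≤ ·) C) (hx : x ∈ C)
    (hxS : (D.pos x).2 ∈ S) : f (D.pos x).2 = (D.pos x).1 := by
  obtain ⟨d, e, hde, hp⟩ := hf.exists_step _ hxS
  exact congrArg Prod.fst (D.eq_pos_of_mem_segment hde.2.2.lt (hde.le_or_le hC hx) hp rfl)

theorem Traces.exists_mem_segment_iff (hf : D.Traces C S f) (hC : IsChain (· ≤ ·) C) {h : ℝ}
    (hh : h ∈ S) {P : ℝ → Prop} :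
    (∃ u ∈ C, ∃ v ∈ C, u ⋖ v ∧ ∃ t ∈ segment ℝ (D.pos u) (D.pos v), t.2 = h ∧ P t.1) ↔
      P (f h) := by
  obtain ⟨d, e, hde, hp⟩ := hf.exists_step h hh
  constructor
  · rintro ⟨u, hu, v, hv, huv, t, ht, hth, hP⟩
    obtain rfl := D.eq_of_mem_segment_of_isChain hC ⟨hu, hv, huv⟩ hde ht hp hth
    exact hP
  · exact fun hP => ⟨d, hde.1, e, hde.2.1, hde.2.2, _, hp, rfl, hP⟩

theorem Traces.leftOfChain_iff (hf : D.Traces C S f) (hC : IsChain (· ≤ ·) C)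
    (hx : (D.pos x).2 ∈ S) : D.LeftOfChain C x ↔ (D.pos x).1 ≤ f (D.pos x).2 :=
  hf.exists_mem_segment_iff hC hx

theorem Traces.rightOfChain_iff (hf : D.Traces C S f) (hC : IsChain (· ≤ ·) C)
    (hx : (D.pos x).2 ∈ S) : D.RightOfChain C x ↔ f (D.pos x).2 ≤ (D.pos x).1 :=
  hf.exists_mem_segment_iff hC hx (P := (· ≤ (D.pos x).1))

end Traces

end PlanarDiagram

/-- The elements `x`, `y`, `z`, `w` form a square in the covering relation: `x` is covered by `y`
and by `z`, and both are covered by `w`. -/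
structure IsCoveringSquare {L : Type*} [Lattice L] (x y z w : L) : Prop where
  covBy_left : x ⋖ y
  covBy_right : x ⋖ z
  left_covBy : y ⋖ w
  right_covBy : z ⋖ w
  ne : y ≠ z

section CoveringSquare

variable {L : Type*} [Lattice L] {x y z w : L}

theorem inf_eq_of_covBy_of_covBy (hxy : x ⋖ y) (hxz : x ⋖ z) (hyz : y ≠ z) : y ⊓ z = x :=
  (hxy.eq_or_eq (le_inf hxy.le hxz.le) inf_le_left).resolve_right fun h =>
    hyz ((hxz.eq_or_eq hxy.le (inf_eq_left.1 h)).resolve_left hxy.lt.ne')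

theorem sup_eq_of_covBy_of_covBy (hxz : x ⋖ z) (hyz : y ⋖ z) (hxy : x ≠ y) : x ⊔ y = z :=
  inf_eq_of_covBy_of_covBy (L := Lᵒᵈ) hxz.toDual hyz.toDual hxy

namespace IsCoveringSquare

theorem symm (h : IsCoveringSquare x y z w) : IsCoveringSquare x z y w :=
  ⟨h.covBy_right, h.covBy_left, h.right_covBy, h.left_covBy, h.ne.symm⟩

theorem inf_eq (h : IsCoveringSquare x y z w) : y ⊓ z = x :=
  inf_eq_of_covBy_of_covBy h.covBy_left h.covBy_right h.ne

theorem sup_eq (h : IsCoveringSquare x y z w) : y ⊔ z = w :=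
  sup_eq_of_covBy_of_covBy h.left_covBy h.right_covBy h.ne

theorem of_covBy [IsUpperModularLattice L] (hxy : x ⋖ y) (hxz : x ⋖ z) (hyz : y ≠ z) :
    IsCoveringSquare x y z (y ⊔ z) where
  covBy_left := hxy
  covBy_right := hxz
  left_covBy := covBy_sup_of_inf_covBy_right (by rwa [inf_eq_of_covBy_of_covBy hxy hxz hyz])
  right_covBy := covBy_sup_of_inf_covBy_left (by rwa [inf_eq_of_covBy_of_covBy hxy hxz hyz])
  ne := hyz

theorem lt (h : IsCoveringSquare x y z w) : x < w :=
  h.covBy_left.lt.trans h.left_covBy.lt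

theorem not_covBy (h : IsCoveringSquare x y z w) : ¬ x ⋖ w :=
  fun hxw => hxw.2 h.covBy_left.lt h.left_covBy.lt

theorem not_le (h : IsCoveringSquare x y z w) : ¬ y ≤ z :=
  fun hyz => h.covBy_left.lt.ne (h.inf_eq.symm.trans (inf_eq_left.2 hyz))

theorem ncard_eq_four (h : IsCoveringSquare x y z w) : ({x, y, z, w} : Set L).ncard = 4 := by
  rw [Set.ncard_insert_of_notMem, Set.ncard_eq_three.2 ⟨y, z, w, h.ne, h.left_covBy.lt.ne,
    h.right_covBy.lt.ne, rfl⟩]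
  rintro (hx | hx | hx)
  exacts [h.covBy_left.lt.ne hx, h.covBy_right.lt.ne hx, h.lt.ne hx]

theorem inter_eq (h : IsCoveringSquare x y z w) :
    ({x, y, w} : Set L) ∩ {x, z, w} = {x, w} := by
  ext t
  simp only [Set.mem_inter_iff, Set.mem_insert_iff, Set.mem_singleton_iff]
  have := h.ne
  grind

theorem sdiff_eq (h : IsCoveringSquare x y z w) : ({x, y, w} : Set L) \ {x, w} = {y} := by
  ext t
  simp only [Set.mem_sdiff, Set.mem_insert_iff, Set.mem_singleton_iff]
  have := h.covBy_left.lt.ne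
  have := h.left_covBy.lt.ne
  grind

theorem Icc_subset [Finite L] (h : IsCoveringSquare x y z w) (hx : {t | x ⋖ t}.ncard ≤ 2) :
    Set.Icc x w ⊆ {x, y, z, w} := by
  have hcovers : {y, z} = {t | x ⋖ t} :=
    Set.eq_of_subset_of_ncard_le (Set.pair_subset h.covBy_left h.covBy_right)
      (by rwa [Set.ncard_pair h.ne])
  rintro t ⟨hxt, htw⟩
  obtain rfl | hlt := hxt.eq_or_lt
  · exact .inl rfl
  · obtain ⟨v, hxv, hvt⟩ := exists_covBy_le_of_lt hlt
    obtain rfl | rfl : v ∈ ({y, z} : Set L) := hcovers ▸ hxv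
    · obtain rfl | rfl := h.left_covBy.eq_or_eq hvt htw <;> simp
    · obtain rfl | rfl := h.right_covBy.eq_or_eq hvt htw <;> simp

theorem edgeOf (h : IsCoveringSquare x y z w) {r : PrimeInterval L}
    (hr : PlanarDiagram.EdgeOf r {x, y, z, w}) :
    (r.lo = x ∧ r.hi = y) ∨ (r.lo = x ∧ r.hi = z) ∨ (r.lo = y ∧ r.hi = w) ∨
      (r.lo = z ∧ r.hi = w) := by
  obtain ⟨hlo, hhi⟩ := hr
  simp only [Set.mem_insert_iff, Set.mem_singleton_iff] at hlo hhi
  have hlt := r.covBy.lt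
  have hxw : ¬ (r.lo = x ∧ r.hi = w) := by
    rintro ⟨rfl, rfl⟩
    exact h.not_covBy r.covBy
  have hyz : ¬ (r.lo = y ∧ r.hi = z) := by
    rintro ⟨rfl, rfl⟩
    exact h.not_le hlt.le
  have hzy : ¬ (r.lo = z ∧ r.hi = y) := by
    rintro ⟨rfl, rfl⟩
    exact h.symm.not_le hlt.le
  have := h.covBy_left.lt
  have := h.covBy_right.lt
  have := h.left_covBy.lt
  have := h.right_covBy.lt
  grind

theorem rel_iff_rel (h : IsCoveringSquare x y z w) (θ : LatticeCon L) : θ.r x y ↔ θ.r z w := by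
  constructor <;> intro hrel
  · have hsup := θ.sup hrel (θ.refl z)
    rwa [sup_eq_right.2 h.covBy_right.le, h.sup_eq] at hsup
  · have hinf := θ.inf hrel (θ.refl y)
    rwa [h.symm.inf_eq, inf_eq_right.2 h.left_covBy.le] at hinf

end IsCoveringSquare

end CoveringSquare

theorem IsSlim.ncard_upperCovers_le_two {L : Type*} [Lattice L] [Finite L] (hslim : IsSlim L)
    (x : L) : {y | x ⋖ y}.ncard ≤ 2 := by
  classical
  have hirr (y : {y | x ⋖ y}) : ∃ j, SupIrred j ∧ x ⊔ j = y := by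
    obtain ⟨j, hj, hjy, hjx⟩ := exists_supIrred_le_not_le y.2.lt.not_ge
    exact ⟨j, hj, (y.2.eq_or_eq le_sup_left (sup_le y.2.le hjy)).resolve_left
      fun h => hjx (sup_eq_left.1 h)⟩
  choose j hj hsup using hirr
  have hle {y z : {y | x ⋖ y}} (hjyz : j y ≤ j z) : y = z := by
    have hyz : (y : L) ≤ z := by
      rw [← hsup y, ← hsup z]
      exact sup_le_sup_left hjyz x
    exact Subtype.ext ((z.2.eq_or_eq y.2.le hyz).resolve_left y.2.lt.ne')
  have hinj : Function.Injective j := fun y z h => hle h.le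
  rw [← Nat.card_coe_set_eq, ← Set.ncard_univ, ← Set.ncard_image_of_injective _ hinj,
    Set.ncard_eq_toFinset_card]
  refine hslim.card_le_two (fun x hx => ?_) ?_
  · obtain ⟨y, -, rfl⟩ := (Set.Finite.mem_toFinset _).1 hx
    exact hj y
  · rw [Set.Finite.coe_toFinset]
    rintro _ ⟨y, -, rfl⟩ _ ⟨z, -, rfl⟩ hne hjyz
    exact hne (congrArg j (hle hjyz))

namespace PlanarDiagram

section MaxChain

variable {L : Type*} [Lattice L] {a b c x y : L} {C : Set L}

theorem IsMaxChainIn.mem_of_forall (hC : IsMaxChainIn a b C) (hx : x ∈ Set.Icc a b)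
    (hcomp : ∀ y ∈ C, x ≤ y ∨ y ≤ x) : x ∈ C :=
  hC.2 (y := insert x C) ⟨Set.insert_subset hx hC.1.1, hC.1.2.insert fun y hy _ => hcomp y hy⟩
    (Set.subset_insert x C) (Set.mem_insert x C)

theorem IsMaxChainIn.left_mem (hC : IsMaxChainIn a b C) (hab : a ≤ b) : a ∈ C :=
  hC.mem_of_forall ⟨le_rfl, hab⟩ fun _ hx => .inl (hC.1.1 hx).1

theorem IsMaxChainIn.right_mem (hC : IsMaxChainIn a b C) (hab : a ≤ b) : b ∈ C :=
  hC.mem_of_forall ⟨hab, le_rfl⟩ fun _ hx => .inr (hC.1.1 hx).2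

theorem IsMaxChainIn.exists_step [Finite L] (hC : IsMaxChainIn a b C) (hx : x ∈ C)
    (hxb : x ≠ b) : ∃ y, Step C x y := by
  have hab : a ≤ b := (hC.1.1 hx).1.trans (hC.1.1 hx).2
  obtain ⟨y, ⟨hyC, hxy⟩, hymin⟩ := (Set.toFinite {y ∈ C | x < y}).exists_minimal
    ⟨b, hC.right_mem hab, (hC.1.1 hx).2.lt_of_ne hxb⟩
  refine ⟨y, hx, hyC, hxy, fun t hxt hty => ?_⟩
  have hcomp (w : L) (hw : w ∈ C) : t ≤ w ∨ w ≤ t := by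
    obtain hwx | hxw := hC.1.2.total hw hx
    · exact .inr (hwx.trans hxt.le)
    obtain rfl | hxw := hxw.eq_or_lt
    · exact .inr hxt.le
    obtain hwy | hyw := hC.1.2.total hw hyC
    · exact .inl (hty.le.trans (hymin ⟨hw, hxw⟩ hwy))
    · exact .inl (hty.le.trans hyw)
  have htC : t ∈ C :=
    hC.mem_of_forall ⟨(hC.1.1 hx).1.trans hxt.le, hty.le.trans (hC.1.1 hyC).2⟩ hcomp
  exact hty.not_ge (hymin ⟨htC, hxt⟩ hty.le)

theorem IsMaxChainIn.reflTransGen_step [Finite L] (hC : IsMaxChainIn a b C) (hx : x ∈ C) :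
    Relation.ReflTransGen (Step C) x b := by
  induction x using WellFoundedGT.induction with
  | ind x ih =>
    by_cases hxb : x = b
    · rw [hxb]
    · obtain ⟨y, hxy⟩ := hC.exists_step hx hxb
      exact .head hxy (ih y hxy.2.2.lt hxy.2.1)

theorem isMaxChainIn_triple (hax : a ⋖ x) (hxb : x ⋖ b) : IsMaxChainIn a b {a, x, b} := by
  have hab := hax.le.trans hxb.le
  refine ⟨⟨?_, ?_⟩, ?_⟩
  · rintro t (rfl | rfl | rfl)
    exacts [⟨le_rfl, hab⟩, ⟨hax.le, hxb.le⟩, ⟨hab, le_rfl⟩]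
  · rintro s (rfl | rfl | rfl) t (rfl | rfl | rfl) _ <;>
      simp [hax.le, hxb.le, hab]
  · rintro E ⟨hE, hchain⟩ hsub t ht
    obtain htx | hxt := hchain.total ht (hsub (.inr (.inl rfl)))
    · obtain rfl | rfl := hax.eq_or_eq (hE ht).1 htx <;> simp
    · obtain rfl | rfl := hxb.eq_or_eq hxt (hE ht).2 <;> simp

theorem IsMaxChainIn.exists_mem_sdiff [Finite L] (hC : IsMaxChainIn a b C) (hab : a < b)
    (hcov : ¬ a ⋖ b) : ∃ c, c ∈ C \ {a, b} := by
  obtain ⟨c, -, hc, hac⟩ := hC.exists_step (hC.left_mem hab.le) hab.ne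
  refine ⟨c, hc, ?_⟩
  rintro (rfl | rfl)
  exacts [hac.lt.false, hcov hac]

theorem IsMaxChainIn.covBy_of_subset [Finite L] (hC : IsMaxChainIn a b C) (hab : a < b)
    (hcov : ¬ a ⋖ b) (hsub : C ⊆ {a, c, b}) : a ⋖ c ∧ c ⋖ b := by
  obtain ⟨y, hy⟩ := hC.exists_step (hC.left_mem hab.le) hab.ne
  obtain rfl | rfl | rfl := hsub hy.2.1
  · exact (hy.2.2.lt.false).elim
  · have hyb : y ≠ b := fun h => hcov (h ▸ hy.2.2)
    obtain ⟨w, hw⟩ := hC.exists_step hy.2.1 hyb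
    obtain rfl | rfl | rfl := hsub hw.2.1
    · exact (hw.2.2.lt.not_gt hy.2.2.lt).elim
    · exact (hw.2.2.lt.false).elim
    · exact ⟨hy.2.2, hw.2.2⟩
  · exact (hcov hy.2.2).elim

end MaxChain

section Regions

variable {L : Type*} [Lattice L] {D : PlanarDiagram L} {a b x y z w : L} {C C₁ C₂ R S : Set L}

theorem height_mem_Icc (D : PlanarDiagram L) (hx : x ∈ Set.Icc a b) :
    (D.pos x).2 ∈ Set.Icc (D.pos a).2 (D.pos b).2 :=
  ⟨D.strictMono_height.monotone hx.1, D.strictMono_height.monotone hx.2⟩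

theorem Traces.lt_of_le_of_inter_eq {f g : ℝ → ℝ}
    (hf : D.Traces C₁ (Set.Icc (D.pos a).2 (D.pos b).2) f)
    (hg : D.Traces C₂ (Set.Icc (D.pos a).2 (D.pos b).2) g) (hab : a < b) (hcov : ¬ a ⋖ b)
    (hinter : C₁ ∩ C₂ = {a, b}) {s t : ℝ} (hs : s ∈ Set.Ioo (D.pos a).2 (D.pos b).2)
    (ht : t ∈ Set.Ioo (D.pos a).2 (D.pos b).2) (hfg : f s ≤ g s) : f t < g t := by
  refine (hf.mono Set.Ioo_subset_Icc_self).lt_of_le (hg.mono Set.Ioo_subset_Icc_self)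
    (fun d e hde => ?_) (fun v hv hmem => ?_) hs ht hfg
  · rw [hinter] at hde
    obtain ⟨rfl | rfl, rfl | rfl, hde⟩ := hde
    exacts [hde.lt.false, hcov hde, hde.lt.not_gt hab, hde.lt.false]
  · rw [hinter] at hv
    obtain rfl | rfl := hv
    exacts [hmem.1.false, hmem.2.false]

variable [Finite L]

theorem IsMaxChainIn.exists_traces (D : PlanarDiagram L) (hC : IsMaxChainIn a b C) (hab : a < b) :
    ∃ f, D.Traces C (Set.Icc (D.pos a).2 (D.pos b).2) f := by
  obtain ⟨y, hay, hyb⟩ := (Relation.ReflTransGen.cases_tail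
    (hC.reflTransGen_step (hC.left_mem hab.le))).resolve_left hab.ne'
  obtain ⟨f, hf, -⟩ := D.exists_traces hay hyb
  exact ⟨f, hf⟩

theorem IsMaxChainIn.rightOfChain_or_leftOfChain (D : PlanarDiagram L) (hC : IsMaxChainIn a b C)
    (hab : a < b) (hx : x ∈ Set.Icc a b) : D.RightOfChain C x ∨ D.LeftOfChain C x := by
  obtain ⟨f, hf⟩ := hC.exists_traces D hab
  rw [hf.rightOfChain_iff hC.1.2 (D.height_mem_Icc hx),
    hf.leftOfChain_iff hC.1.2 (D.height_mem_Icc hx)]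
  exact le_total _ _

theorem IsMaxChainIn.rightOfChain_and_leftOfChain (D : PlanarDiagram L) (hC : IsMaxChainIn a b C)
    (hab : a < b) (hx : x ∈ C) : D.RightOfChain C x ∧ D.LeftOfChain C x := by
  have hx' := D.height_mem_Icc (hC.1.1 hx)
  obtain ⟨f, hf⟩ := hC.exists_traces D hab
  rw [hf.rightOfChain_iff hC.1.2 hx', hf.leftOfChain_iff hC.1.2 hx',
    hf.apply_height hC.1.2 hx hx']
  exact ⟨le_rfl, le_rfl⟩

theorem leftOfChain_iff_rightOfChain (h₁ : IsMaxChainIn a b C₁) (h₂ : IsMaxChainIn a b C₂)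
    (hab : a < b) (hcov : ¬ a ⋖ b) (hinter : C₁ ∩ C₂ = {a, b}) (hx : x ∈ C₁ \ {a, b})
    (hy : y ∈ C₂ \ {a, b}) : D.LeftOfChain C₂ x ↔ D.RightOfChain C₁ y := by
  obtain ⟨f, hf⟩ := h₁.exists_traces D hab
  obtain ⟨g, hg⟩ := h₂.exists_traces D hab
  have hIoo {z : L} (hz : z ∈ Set.Icc a b) (hz' : z ∉ ({a, b} : Set L)) :
      (D.pos z).2 ∈ Set.Ioo (D.pos a).2 (D.pos b).2 :=
    ⟨D.height_lt (hz.1.lt_of_ne fun h => hz' (.inl h.symm)),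
      D.height_lt (hz.2.lt_of_ne fun h => hz' (.inr h))⟩
  have hx' := hIoo (h₁.1.1 hx.1) hx.2
  have hy' := hIoo (h₂.1.1 hy.1) hy.2
  rw [hg.leftOfChain_iff h₂.1.2 (Set.Ioo_subset_Icc_self hx'),
    hf.rightOfChain_iff h₁.1.2 (Set.Ioo_subset_Icc_self hy'),
    ← hf.apply_height h₁.1.2 hx.1 (Set.Ioo_subset_Icc_self hx'),
    ← hg.apply_height h₂.1.2 hy.1 (Set.Ioo_subset_Icc_self hy')]
  exact ⟨fun h => (hf.lt_of_le_of_inter_eq hg hab hcov hinter hx' hy' h).le,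
    fun h => (hf.lt_of_le_of_inter_eq hg hab hcov hinter hy' hx' h).le⟩

theorem union_subset_region (h₁ : IsMaxChainIn a b C₁) (h₂ : IsMaxChainIn a b C₂) (hab : a < b)
    (hcov : ¬ a ⋖ b) (hinter : C₁ ∩ C₂ = {a, b})
    (hright : ∀ x ∈ C₂ \ {a, b}, D.RightOfChain C₁ x) :
    C₁ ∪ C₂ ⊆ {x | x ∈ Set.Icc a b ∧ D.RightOfChain C₁ x ∧ D.LeftOfChain C₂ x} := by
  obtain ⟨y, hy⟩ := h₂.exists_mem_sdiff hab hcov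
  have hends : {a, b} ⊆ C₁ ∩ C₂ := hinter.ge
  rintro x (hx | hx)
  · refine ⟨h₁.1.1 hx, (h₁.rightOfChain_and_leftOfChain D hab hx).1, ?_⟩
    by_cases hxab : x ∈ ({a, b} : Set L)
    · exact (h₂.rightOfChain_and_leftOfChain D hab (hends hxab).2).2
    · exact (leftOfChain_iff_rightOfChain h₁ h₂ hab hcov hinter ⟨hx, hxab⟩ hy).2 (hright y hy)
  · refine ⟨h₂.1.1 hx, ?_, (h₂.rightOfChain_and_leftOfChain D hab hx).2⟩
    by_cases hxab : x ∈ ({a, b} : Set L)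
    · exact (h₁.rightOfChain_and_leftOfChain D hab (hends hxab).1).1
    · exact hright x ⟨hx, hxab⟩

theorem IsRegion.exists_subset (hR : D.IsRegion R) :
    ∃ a b c d C₁ C₂, a < b ∧ ¬ a ⋖ b ∧ IsMaxChainIn a b C₁ ∧ IsMaxChainIn a b C₂ ∧
      c ∈ C₁ \ C₂ ∧ d ∈ C₂ \ C₁ ∧ C₁ ∪ C₂ ⊆ R ∧ {a, c, d, b} ⊆ R ∧
      ({a, c, d, b} : Set L).ncard = 4 := by
  obtain ⟨a, b, C₁, C₂, hab, hcov, h₁, h₂, hinter, hright, rfl⟩ := hR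
  have hsub := union_subset_region h₁ h₂ hab hcov hinter hright
  obtain ⟨c, hc, hcab⟩ := h₁.exists_mem_sdiff hab hcov
  obtain ⟨d, hd, hdab⟩ := h₂.exists_mem_sdiff hab hcov
  have hc₂ : c ∉ C₂ := fun h => hcab (hinter ▸ ⟨hc, h⟩)
  have hd₁ : d ∉ C₁ := fun h => hdab (hinter ▸ ⟨h, hd⟩)
  refine ⟨a, b, c, d, C₁, C₂, hab, hcov, h₁, h₂, ⟨hc, hc₂⟩, ⟨hd, hd₁⟩, hsub, ?_, ?_⟩
  · rintro t (rfl | rfl | rfl | rfl)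
    exacts [hsub (.inl (h₁.left_mem hab.le)), hsub (.inl hc), hsub (.inr hd),
      hsub (.inl (h₁.right_mem hab.le))]
  · rw [Set.ncard_insert_of_notMem, Set.ncard_eq_three.2 ⟨c, d, b, ?_, ?_, ?_, rfl⟩]
    · rintro rfl
      exact hc₂ hd
    · exact fun h => hcab (.inr h)
    · exact fun h => hdab (.inr h)
    · rintro (rfl | rfl | rfl)
      exacts [hcab (.inl rfl), hdab (.inl rfl), hab.false]

theorem IsFourCell.exists_isCoveringSquare (hS : D.IsFourCell S) :
    ∃ x y z w, S = {x, y, z, w} ∧ IsCoveringSquare x y z w := by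
  obtain ⟨a, b, c, d, C₁, C₂, hab, hcov, h₁, h₂, hc, hd, hsub, hsub', hcard⟩ :=
    hS.1.prop.exists_subset
  obtain rfl : {a, c, d, b} = S := Set.eq_of_subset_of_ncard_le hsub' (by rw [hcard, hS.2])
  obtain ⟨hac, hcb⟩ := h₁.covBy_of_subset (c := c) hab hcov fun t ht => by
    obtain rfl | rfl | rfl | rfl := hsub (.inl ht)
    exacts [.inl rfl, .inr (.inl rfl), (hd.2 ht).elim, .inr (.inr rfl)]
  obtain ⟨had, hdb⟩ := h₂.covBy_of_subset (c := d) hab hcov fun t ht => by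
    obtain rfl | rfl | rfl | rfl := hsub (.inr ht)
    exacts [.inl rfl, (hc.2 ht).elim, .inr (.inl rfl), .inr (.inr rfl)]
  exact ⟨a, c, d, b, rfl, hac, had, hcb, hdb, fun h => hc.2 (h ▸ hd.1)⟩

theorem isRegion_of_rightOfChain (h : IsCoveringSquare x y z w)
    (hIcc : Set.Icc x w ⊆ {x, y, z, w}) (hz : D.RightOfChain {x, y, w} z) :
    D.IsRegion {x, y, z, w} := by
  have hy' := isMaxChainIn_triple h.covBy_left h.left_covBy
  have hz' := isMaxChainIn_triple h.covBy_right h.right_covBy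
  have hright : ∀ t ∈ ({x, z, w} : Set L) \ {x, w}, D.RightOfChain {x, y, w} t := by
    rw [h.symm.sdiff_eq]
    rintro t rfl
    exact hz
  refine ⟨x, w, _, _, h.lt, h.not_covBy, hy', hz', h.inter_eq, hright,
    Set.Subset.antisymm ?_ fun t ht => hIcc ht.1⟩
  refine Set.Subset.trans ?_ (union_subset_region hy' hz' h.lt h.not_covBy h.inter_eq hright)
  rintro t (rfl | rfl | rfl | rfl) <;> simp

theorem isRegion_of_Icc_subset (D : PlanarDiagram L) (h : IsCoveringSquare x y z w)
    (hIcc : Set.Icc x w ⊆ {x, y, z, w}) : D.IsRegion {x, y, z, w} := by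
  have hy' := isMaxChainIn_triple h.covBy_left h.left_covBy
  have hz' := isMaxChainIn_triple h.covBy_right h.right_covBy
  obtain hz | hz := hy'.rightOfChain_or_leftOfChain D h.lt ⟨h.covBy_right.le, h.right_covBy.le⟩
  · exact isRegion_of_rightOfChain h hIcc hz
  · have hy : D.RightOfChain {x, z, w} y :=
      (leftOfChain_iff_rightOfChain hz' hy' h.lt h.not_covBy h.symm.inter_eq
        (h.symm.sdiff_eq.ge rfl) (h.sdiff_eq.ge rfl)).1 hz
    rw [Set.insert_comm y z] at hIcc ⊢
    exact isRegion_of_rightOfChain h.symm hIcc hy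

theorem isFourCell_of_Icc_subset (D : PlanarDiagram L) (h : IsCoveringSquare x y z w)
    (hIcc : Set.Icc x w ⊆ {x, y, z, w}) : D.IsFourCell {x, y, z, w} := by
  refine ⟨⟨D.isRegion_of_Icc_subset h hIcc, fun R hR hsub => ?_⟩, h.ncard_eq_four⟩
  obtain ⟨a, b, c, d, -, -, -, -, -, -, -, -, -, hsub', hcard⟩ := IsRegion.exists_subset hR
  have hR4 : 4 ≤ R.ncard := hcard.symm.trans_le (Set.ncard_le_ncard hsub')
  exact (Set.eq_of_subset_of_ncard_le hsub (h.ncard_eq_four.trans_le hR4)).ge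

end Regions

section LowerCovers

variable {L : Type*} [Lattice L] {D : PlanarDiagram L} {a b t w x x' y y' z : L}

/-- In the left-to-right order of the lower covers of `z`, the element `m` lies strictly between `a`
and `b`. -/
def Between (D : PlanarDiagram L) (z a m b : L) : Prop :=
  D.descentSlope z m ∈ Set.uIoo (D.descentSlope z a) (D.descentSlope z b)

/-- `x` and `y` are adjacent in the left-to-right order of the lower covers of `z`. -/
structure Neighbors (D : PlanarDiagram L) (z x y : L) : Prop where
  left_covBy : x ⋖ z
  right_covBy : y ⋖ z
  ne : x ≠ y
  not_between : ∀ t, t ⋖ z → ¬ D.Between z x t y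

theorem between_iff : D.Between z x w y ↔
    (D.descentSlope z x < D.descentSlope z w ∧ D.descentSlope z w < D.descentSlope z y) ∨
      (D.descentSlope z y < D.descentSlope z w ∧ D.descentSlope z w < D.descentSlope z x) := by
  rw [Between, Set.uIoo_eq_union]
  rfl

theorem Between.symm (h : D.Between z x w y) : D.Between z y w x := by
  rwa [Between, Set.uIoo_comm]

theorem Between.trans_left (h : D.Between z x w y) (ht : D.Between z x t w) :
    D.Between z x t y := by
  rw [between_iff] at *
  grind

theorem Between.ne_left (h : D.Between z x w y) : w ≠ x := by
  rintro rfl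
  exact Set.left_notMem_uIoo h

theorem Between.not_isLeftmostLowerCover (h : D.Between z x w y) (hx : x ⋖ z) (hy : y ⋖ z) :
    ¬ D.IsLeftmostLowerCover z w :=
  fun hw => (between_iff.1 h).elim (fun h => h.1.not_ge (hw.2 x hx)) fun h => h.1.not_ge (hw.2 y hy)

theorem Between.not_isRightmostLowerCover (h : D.Between z x w y) (hx : x ⋖ z) (hy : y ⋖ z) :
    ¬ D.IsRightmostLowerCover z w :=
  fun hw => (between_iff.1 h).elim (fun h => h.2.not_ge (hw.2 y hy)) fun h => h.2.not_ge (hw.2 x hx)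

theorem exists_between (hx : x ⋖ z) (hw : w ⋖ z) (hxw : x ≠ w)
    (hleft : ¬ D.IsLeftmostLowerCover z w) (hright : ¬ D.IsRightmostLowerCover z w) :
    ∃ y, y ⋖ z ∧ D.Between z x w y := by
  simp only [IsLeftmostLowerCover, IsRightmostLowerCover, not_and, not_forall, not_le]
    at hleft hright
  obtain ⟨a, ha, haw⟩ := hleft hw
  obtain ⟨b, hb, hwb⟩ := hright hw
  obtain hlt | hlt := ((D.descentSlope_injOn z).ne hx hw hxw).lt_or_gt
  · exact ⟨b, hb, between_iff.2 (.inl ⟨hlt, hwb⟩)⟩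
  · exact ⟨a, ha, between_iff.2 (.inr ⟨haw, hlt⟩)⟩

theorem between_or_between_or_between (hx : x ⋖ z) (hy : y ⋖ z) (ht : t ⋖ z) (hxy : x ≠ y)
    (hxt : x ≠ t) (hyt : y ≠ t) :
    D.Between z x t y ∨ D.Between z t x y ∨ D.Between z x y t := by
  have h₁ := (D.descentSlope_injOn z).ne hx hy hxy
  have h₂ := (D.descentSlope_injOn z).ne hx ht hxt
  have h₃ := (D.descentSlope_injOn z).ne hy ht hyt
  simp only [between_iff]
  grind

variable [Finite L]

theorem Between.inf_le (h : D.Between z x w y) (hx : x ⋖ z) (hw : w ⋖ z) (hy : y ⋖ z) :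
    x ⊓ y ≤ w := by
  obtain ⟨h₁, h₂⟩ | ⟨h₁, h₂⟩ := between_iff.1 h
  · exact D.inf_le_of_descentSlope_lt hx hw hy h₁ h₂
  · rw [inf_comm]
    exact D.inf_le_of_descentSlope_lt hy hw hx h₁ h₂

theorem Between.three_le_ncard (h : D.Between z x w y) (hx : x ⋖ z) (hw : w ⋖ z) (hy : y ⋖ z) :
    3 ≤ {t | t ⋖ z}.ncard := by
  have hxy : x ≠ y := by
    rintro rfl
    rw [between_iff] at h
    grind
  exact (Set.two_lt_ncard (Set.toFinite _)).2
    ⟨x, hx, w, hw, y, hy, h.ne_left.symm, hxy, h.symm.ne_left⟩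

theorem lowerCover_induction (D : PlanarDiagram L) {P : L → L → Prop}
    (neighbors : ∀ x y, D.Neighbors z x y → P x y)
    (between : ∀ x w y, x ⋖ z → w ⋖ z → y ⋖ z → D.Between z x w y → P x w → P w y → P x y)
    (hx : x ⋖ z) (hy : y ⋖ z) (hxy : x ≠ y) : P x y := by
  induction hn : {t | D.Between z x t y}.ncard using Nat.strong_induction_on
    generalizing x y with
  | _ n ih =>
    subst hn
    by_cases h : ∃ w, w ⋖ z ∧ D.Between z x w y
    · obtain ⟨w, hw, hxwy⟩ := h
      have hleft : {t | D.Between z x t w} ⊂ {t | D.Between z x t y} :=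
        Set.ssubset_iff_of_subset (fun t ht => hxwy.trans_left ht) |>.2
          ⟨w, hxwy, Set.right_notMem_uIoo⟩
      have hright : {t | D.Between z w t y} ⊂ {t | D.Between z x t y} :=
        Set.ssubset_iff_of_subset (fun t ht => (hxwy.symm.trans_left ht.symm).symm) |>.2
          ⟨w, hxwy, Set.left_notMem_uIoo⟩
      exact between x w y hx hw hy hxwy
        (ih _ (Set.ncard_lt_ncard hleft) hx hw hxwy.ne_left.symm rfl)
        (ih _ (Set.ncard_lt_ncard hright) hw hy hxwy.symm.ne_left rfl)
    · exact neighbors x y ⟨hx, hy, hxy, fun t ht hxty => h ⟨t, ht, hxty⟩⟩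

theorem Neighbors.sup_eq (h : D.Neighbors z x y) (hx' : x' ≤ x) (hx'y : ¬ x' ≤ y) (hy' : y' ≤ y)
    (hy'x : ¬ y' ≤ x) : x' ⊔ y' = z := by
  by_contra hne
  obtain ⟨t, hsup, ht⟩ := exists_le_covBy_of_lt
    ((sup_le (hx'.trans h.left_covBy.le) (hy'.trans h.right_covBy.le)).lt_of_ne hne)
  have hx't : x' ≤ t := le_sup_left.trans hsup
  have hy't : y' ≤ t := le_sup_right.trans hsup
  have hxt : x ≠ t := fun h => hy'x (h ▸ hy't)
  have hyt : y ≠ t := fun h => hx'y (h ▸ hx't)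
  obtain hbtw | hbtw | hbtw :=
    between_or_between_or_between h.left_covBy h.right_covBy ht h.ne hxt hyt
  · exact h.not_between t ht hbtw
  · exact hy'x ((le_inf hy't hy').trans (hbtw.inf_le ht h.left_covBy h.right_covBy))
  · exact hx'y ((le_inf hx' hx't).trans (hbtw.inf_le h.left_covBy h.right_covBy ht))

theorem Neighbors.isCoveringSquare [IsUpperModularLattice L] (h : D.Neighbors z x y) :
    IsCoveringSquare (x ⊓ y) x y z := by
  have hxy : ¬ x ≤ y := fun hxy =>
    h.ne ((h.left_covBy.eq_or_eq hxy h.right_covBy.le).resolve_right h.right_covBy.lt.ne).symm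
  have hyx : ¬ y ≤ x := fun hyx =>
    h.ne ((h.right_covBy.eq_or_eq hyx h.left_covBy.le).resolve_right h.left_covBy.lt.ne)
  obtain ⟨x', hx', hx'x⟩ := exists_covBy_le_of_lt (inf_lt_left.2 hxy)
  obtain ⟨y', hy', hy'y⟩ := exists_covBy_le_of_lt (inf_lt_right.2 hyx)
  have hx'y : ¬ x' ≤ y := fun h => hx'.lt.not_ge (le_inf hx'x h)
  have hy'x : ¬ y' ≤ x := fun h => hy'.lt.not_ge (le_inf h hy'y)
  have hsquare := IsCoveringSquare.of_covBy hx' hy' fun h => hx'y (h ▸ hy'y)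
  rw [h.sup_eq hx'x hx'y hy'y hy'x] at hsquare
  obtain rfl : x = x' := (hsquare.left_covBy.eq_or_eq hx'x h.left_covBy.le).resolve_right
    h.left_covBy.lt.ne
  obtain rfl : y = y' := (hsquare.right_covBy.eq_or_eq hy'y h.right_covBy.le).resolve_right
    h.right_covBy.lt.ne
  exact hsquare

end LowerCovers

end PlanarDiagram

section EdgePaths

variable {L : Type*} [Lattice L] {E : Set (PrimeInterval L)} {x y : L}

/-- There is a maximal chain from `x` up to `y` all of whose edges belong to `E`. -/
def EdgePath (E : Set (PrimeInterval L)) : L → L → Prop :=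
  Relation.ReflTransGen fun u v => ∃ h : u ⋖ v, ⟨u, v, h⟩ ∈ E

theorem EdgePath.of_mem {r : PrimeInterval L} (hr : r ∈ E) : EdgePath E r.lo r.hi :=
  .single ⟨r.covBy, hr⟩

theorem EdgePath.le (h : EdgePath E x y) : x ≤ y := by
  induction h with
  | refl => exact le_rfl
  | tail _ hbc ih => exact ih.trans hbc.1.le

theorem EdgePath.mem {r : PrimeInterval L} (h : EdgePath E r.lo r.hi) : r ∈ E := by
  obtain heq | ⟨w, ⟨hxw, hmem⟩, hwy⟩ := Relation.ReflTransGen.cases_head h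
  · exact (r.covBy.lt.ne heq).elim
  · obtain rfl : w = r.hi :=
      (r.covBy.eq_or_eq hxw.le (EdgePath.le hwy)).resolve_left hxw.lt.ne'
    exact hmem

end EdgePaths

namespace PlanarDiagram

section Steps

variable {L : Type*} [Lattice L] {D : PlanarDiagram L} {p q r s : PrimeInterval L}

/-- `s` may follow `r` in an SS-sequence. -/
def SSStep (D : PlanarDiagram L) (r s : PrimeInterval L) : Prop :=
  D.CellPerspective r s ∨ D.Swings r s

/-- The set `E` of edges contains every edge reached from one of its members by an
SS-sequence. -/
def IsSSClosed (D : PlanarDiagram L) (E : Set (PrimeInterval L)) : Prop :=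
  ∀ ⦃r⦄, r ∈ E → ∀ ⦃s⦄, D.SSStep r s → s ∈ E

theorem reflTransGen_ssStep_iff (D : PlanarDiagram L) :
    Relation.ReflTransGen D.SSStep p q ↔ ∃ (n : ℕ) (r : Fin (n + 1) → PrimeInterval L),
      r 0 = p ∧ r (Fin.last n) = q ∧ D.IsSSSequence r := by
  constructor
  · intro h
    induction h using Relation.ReflTransGen.head_induction_on with
    | refl => exact ⟨0, fun _ => q, rfl, rfl, fun i => i.elim0⟩
    | @head a b hab _ ih =>
      obtain ⟨n, r, hr0, hrn, hr⟩ := ih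
      refine ⟨n + 1, Fin.cons a r, rfl, by rw [← Fin.succ_last, Fin.cons_succ, hrn],
        Fin.cases ?_ fun i => ?_⟩
      · rw [Fin.castSucc_zero, Fin.cons_zero, Fin.cons_succ, hr0]
        exact hab
      · rw [Fin.castSucc_succ, Fin.cons_succ, Fin.cons_succ]
        exact hr i
  · rintro ⟨n, r, rfl, rfl, hr⟩
    suffices h : ∀ i, Relation.ReflTransGen D.SSStep (r 0) (r i) from h _
    exact Fin.induction .refl fun i ih => ih.tail (hr i)

theorem CellPerspective.symm (h : D.CellPerspective r s) : D.CellPerspective s r := by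
  obtain ⟨S, hS, hr, hs, hdisj⟩ := h
  exact ⟨S, hS, hs, hr, hdisj.symm⟩

variable [Finite L]

theorem isFourCell_of_isSlim (D : PlanarDiagram L) (hslim : IsSlim L) {x y z w : L}
    (h : IsCoveringSquare x y z w) : D.IsFourCell {x, y, z, w} :=
  D.isFourCell_of_Icc_subset h (h.Icc_subset (hslim.ncard_upperCovers_le_two x))

theorem cellPerspective_of_isCoveringSquare (D : PlanarDiagram L) (hslim : IsSlim L)
    (h : IsCoveringSquare r.lo r.hi s.lo s.hi) : D.CellPerspective r s := by
  refine ⟨_, D.isFourCell_of_isSlim hslim h, ⟨by simp, by simp⟩, ⟨by simp, by simp⟩, ?_⟩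
  simp only [Set.disjoint_insert_left, Set.disjoint_singleton_left, Set.mem_insert_iff,
    Set.mem_singleton_iff, not_or]
  exact ⟨⟨h.covBy_right.lt.ne, h.lt.ne⟩, h.ne, h.left_covBy.lt.ne⟩

theorem CellPerspective.isCoveringSquare (h : D.CellPerspective r s) :
    IsCoveringSquare r.lo r.hi s.lo s.hi ∨ IsCoveringSquare s.lo s.hi r.lo r.hi := by
  obtain ⟨S, hS, hr, hs, hdisj⟩ := h
  obtain ⟨x, y, z, w, rfl, hsq⟩ := hS.exists_isCoveringSquare
  have hd := Set.disjoint_left.1 hdisj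
  simp only [Set.mem_insert_iff, Set.mem_singleton_iff] at hd
  have hlo := hd (.inl rfl)
  have hhi := hd (.inr rfl)
  obtain ⟨hr₁, hr₂⟩ | ⟨hr₁, hr₂⟩ | ⟨hr₁, hr₂⟩ | ⟨hr₁, hr₂⟩ := hsq.edgeOf hr <;>
    obtain ⟨hs₁, hs₂⟩ | ⟨hs₁, hs₂⟩ | ⟨hs₁, hs₂⟩ | ⟨hs₁, hs₂⟩ := hsq.edgeOf hs <;>
    rw [hr₁, hr₂, hs₁, hs₂] <;>
    grind [IsCoveringSquare.symm]

theorem Neighbors.swings [IsUpperModularLattice L] (hslim : IsSlim L)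
    (h : D.Neighbors r.hi r.lo s.lo) (hhi : r.hi = s.hi)
    (hleft : ¬ D.IsLeftmostLowerCover r.hi s.lo)
    (hright : ¬ D.IsRightmostLowerCover r.hi s.lo) : D.Swings r s := by
  obtain ⟨t, ht, hbtw⟩ := exists_between h.left_covBy h.right_covBy h.ne hleft hright
  refine ⟨fun hrs => h.ne (congrArg PrimeInterval.lo hrs),
    ⟨_, D.isFourCell_of_isSlim hslim h.isCoveringSquare, ⟨by simp, by simp⟩, ?_⟩, hhi,
    hbtw.three_le_ncard h.left_covBy h.right_covBy ht, hleft, hright⟩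
  exact ⟨by simp, by simp [hhi]⟩

end Steps

namespace IsSSClosed

variable {L : Type*} [Lattice L] [Finite L] {D : PlanarDiagram L} {E : Set (PrimeInterval L)}
  {x y z : L}

theorem mem_iff_mem_of_isCoveringSquare (hE : D.IsSSClosed E) (hslim : IsSlim L)
    {r s : PrimeInterval L} (h : IsCoveringSquare r.lo r.hi s.lo s.hi) : r ∈ E ↔ s ∈ E :=
  have hrs := D.cellPerspective_of_isCoveringSquare hslim h
  ⟨fun hr => hE hr (.inl hrs), fun hs => hE hs (.inl hrs.symm)⟩

variable [IsUpperModularLattice L]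

theorem edgePath_sup_of_mem (hE : D.IsSSClosed E) (hslim : IsSlim L) {t : L} (hxy : x ⋖ y)
    (hmem : ⟨x, y, hxy⟩ ∈ E) (hxt : x ≤ t) : EdgePath E t (y ⊔ t) := by
  induction x using WellFoundedGT.induction generalizing y with
  | ind x ih =>
    obtain rfl | hlt := hxt.eq_or_lt
    · rw [sup_eq_left.2 hxy.le]
      exact .of_mem hmem
    · obtain ⟨w, hxw, hwt⟩ := exists_covBy_le_of_lt hlt
      by_cases hyw : y = w
      · rw [sup_eq_right.2 (hyw ▸ hwt)]
        exact .refl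
      · have hsq := IsCoveringSquare.of_covBy hxy hxw hyw
        have hmem' : ⟨w, y ⊔ w, hsq.right_covBy⟩ ∈ E :=
          (hE.mem_iff_mem_of_isCoveringSquare hslim hsq).1 hmem
        have hpath := ih w hxw.lt hsq.right_covBy hmem' hwt
        rwa [sup_assoc, sup_eq_right.2 hwt] at hpath

theorem edgePath_sup (hE : D.IsSSClosed E) (hslim : IsSlim L) (h : EdgePath E x y) (t : L) :
    EdgePath E (x ⊔ t) (y ⊔ t) := by
  induction h with
  | refl => exact .refl
  | @tail b c _ hbc ih =>
    obtain ⟨hcov, hmem⟩ := hbc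
    have hpath := hE.edgePath_sup_of_mem hslim hcov hmem (le_sup_left : b ≤ b ⊔ t)
    rw [← sup_assoc, sup_eq_left.2 hcov.le] at hpath
    exact ih.trans hpath

theorem edgePath_of_not_isLeftmost_of_not_isRightmost (hE : D.IsSSClosed E) (hslim : IsSlim L)
    (hx : x ⋖ z) (hy : y ⋖ z) (hxy : x ≠ y) (hxz : EdgePath E x z)
    (hleft : ¬ D.IsLeftmostLowerCover z y) (hright : ¬ D.IsRightmostLowerCover z y) :
    EdgePath E y z := by
  revert hxz hleft hright
  refine D.lowerCover_induction (P := fun x y => EdgePath E x z → ¬ D.IsLeftmostLowerCover z y →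
    ¬ D.IsRightmostLowerCover z y → EdgePath E y z) (fun x y hnbr hxz hleft hright => ?_)
    (fun x w y hx _ hy hbtw ihxw ihwy hxz => ?_) hx hy hxy
  · have hmem := EdgePath.mem (r := ⟨x, z, hnbr.left_covBy⟩) hxz
    exact .of_mem (r := ⟨y, z, hnbr.right_covBy⟩)
      (hE hmem (.inr (Neighbors.swings hslim hnbr rfl hleft hright)))
  · exact ihwy (ihxw hxz (hbtw.not_isLeftmostLowerCover hx hy)
      (hbtw.not_isRightmostLowerCover hx hy))

theorem edgePath_inf_of_covBy (hE : D.IsSSClosed E) (hslim : IsSlim L)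
    (hinf : ∀ w < z, ∀ x t, EdgePath E x w → EdgePath E (x ⊓ t) (w ⊓ t)) (hx : x ⋖ z)
    (hy : y ⋖ z) (hxy : x ≠ y) (hxz : EdgePath E x z) : EdgePath E (x ⊓ y) y := by
  revert hxz
  refine D.lowerCover_induction (P := fun x y => EdgePath E x z → EdgePath E (x ⊓ y) y)
    (fun x y hnbr hxz => ?_) (fun x w y hx hw hy hbtw ihxw ihwy hxz => ?_) hx hy hxy
  · have hsq := hnbr.isCoveringSquare
    have hmem := EdgePath.mem (r := ⟨x, z, hnbr.left_covBy⟩) hxz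
    exact .of_mem ((hE.mem_iff_mem_of_isCoveringSquare hslim (r := ⟨x ⊓ y, y, hsq.covBy_right⟩)
      hsq.symm).2 hmem)
  · have hwz : EdgePath E w z :=
      hE.edgePath_of_not_isLeftmost_of_not_isRightmost hslim hx hw hbtw.ne_left.symm hxz
        (hbtw.not_isLeftmostLowerCover hx hy) (hbtw.not_isRightmostLowerCover hx hy)
    have hpath := hinf w hw.lt _ y (ihxw hxz)
    rw [inf_right_comm, inf_eq_left.2 (hbtw.inf_le hx hw hy)] at hpath
    exact hpath.trans (ihwy hwz)

theorem edgePath_inf (hE : D.IsSSClosed E) (hslim : IsSlim L) (h : EdgePath E x y) (t : L) :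
    EdgePath E (x ⊓ t) (y ⊓ t) := by
  induction y using WellFoundedLT.induction generalizing x t with
  | ind y ih =>
    obtain rfl | ⟨b, hxb, hby, hmem⟩ := Relation.ReflTransGen.cases_tail h
    · exact .refl
    by_cases hyt : y ≤ t
    · rwa [inf_eq_left.2 hyt, inf_eq_left.2 (h.le.trans hyt)]
    obtain ⟨w, htw, hwy⟩ := exists_le_covBy_of_lt (inf_lt_left.2 hyt)
    have hwt : w ⊓ t = y ⊓ t :=
      le_antisymm (inf_le_inf_right _ hwy.le) (le_inf htw inf_le_right)
    obtain rfl | hbw := eq_or_ne b w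
    · rw [← hwt]
      exact ih b hby.lt hxb t
    · have hbww : EdgePath E (b ⊓ w) w :=
        hE.edgePath_inf_of_covBy hslim (fun v hv x t hxv => ih v hv hxv t) hby hwy hbw
          (.of_mem (r := ⟨b, y, hby⟩) hmem)
      have hbwt : b ⊓ w ⊓ t = b ⊓ t := by
        rw [inf_assoc, hwt, ← inf_assoc, inf_eq_left.2 hby.le]
      have hpath := ih w hwy.lt hbww t
      rw [hbwt, hwt] at hpath
      exact (ih b hby.lt hxb t).trans hpath

/-- The lattice congruence whose collapsed edges are the members of `E`, for a set `E` of edges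
closed under SS-sequences in a slim semimodular lattice. -/
def latticeCon (hE : D.IsSSClosed E) (hslim : IsSlim L) : LatticeCon L :=
  @LatticeCon.mk' L _ (fun x y => EdgePath E (x ⊓ y) (x ⊔ y))
    ⟨fun x => by rw [inf_idem, sup_idem]; exact .refl⟩
    (fun x y => by rw [inf_eq_left.2 inf_le_sup, sup_eq_right.2 inf_le_sup])
    (fun x y z hxy hyz h₁ h₂ => by
      rw [inf_eq_left.2 hxy, sup_eq_right.2 hxy] at h₁
      rw [inf_eq_left.2 hyz, sup_eq_right.2 hyz] at h₂
      rw [inf_eq_left.2 (hxy.trans hyz), sup_eq_right.2 (hxy.trans hyz)]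
      exact h₁.trans h₂)
    (fun x y t hxy h => by
      rw [inf_eq_left.2 hxy, sup_eq_right.2 hxy] at h
      rw [inf_eq_left.2 (inf_le_inf_right t hxy), sup_eq_right.2 (inf_le_inf_right t hxy),
        inf_eq_left.2 (sup_le_sup_right hxy t), sup_eq_right.2 (sup_le_sup_right hxy t)]
      exact ⟨hE.edgePath_inf hslim h t, hE.edgePath_sup hslim h t⟩)

theorem latticeCon_r_iff (hE : D.IsSSClosed E) (hslim : IsSlim L) {r : PrimeInterval L} :
    (hE.latticeCon hslim).r r.lo r.hi ↔ r ∈ E := by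
  change EdgePath E (r.lo ⊓ r.hi) (r.lo ⊔ r.hi) ↔ r ∈ E
  rw [inf_eq_left.2 r.covBy.le, sup_eq_right.2 r.covBy.le]
  exact ⟨EdgePath.mem, EdgePath.of_mem⟩

end IsSSClosed

section Congruence

variable {L : Type*} [Lattice L] [Finite L] {D : PlanarDiagram L} {p q r s : PrimeInterval L}

theorem reflTransGen_ssStep_of_con [IsUpperModularLattice L] (D : PlanarDiagram L)
    (hslim : IsSlim L) (h : (con p.lo p.hi).r q.lo q.hi) :
    Relation.ReflTransGen D.SSStep p q := by
  have hE : D.IsSSClosed {s | Relation.ReflTransGen D.SSStep p s} :=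
    fun _ hr _ hrs => hr.tail hrs
  exact (hE.latticeCon_r_iff hslim).1 (h _ ((hE.latticeCon_r_iff hslim).2 .refl))

theorem CellPerspective.collapse (h : D.CellPerspective r s) (θ : LatticeCon L)
    (hr : θ.r r.lo r.hi) : θ.r s.lo s.hi :=
  h.isCoveringSquare.elim (fun hsq => (hsq.rel_iff_rel θ).1 hr) fun hsq => (hsq.rel_iff_rel θ).2 hr

theorem Swings.collapse (h : D.Swings r s) (θ : LatticeCon L) (hr : θ.r r.lo r.hi) :
    θ.r s.lo s.hi := by
  obtain ⟨hne, -, hhi, -, hleft, hright⟩ := h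
  have hs : s.lo ⋖ r.hi := hhi ▸ s.covBy
  obtain ⟨t, ht, hbtw⟩ := exists_between r.covBy hs (fun h => hne (PrimeInterval.ext h hhi))
    hleft hright
  have hsup : t ⊔ s.lo = r.hi := sup_eq_of_covBy_of_covBy ht hs hbtw.symm.ne_left.symm
  have hrel := θ.sup (θ.inf hr (θ.refl t)) (θ.refl s.lo)
  rwa [sup_eq_right.2 (hbtw.inf_le r.covBy hs ht), inf_eq_right.2 ht.le, hsup, hhi] at hrel

theorem con_of_reflTransGen_ssStep (h : Relation.ReflTransGen D.SSStep p q) :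
    (con p.lo p.hi).r q.lo q.hi := by
  intro θ hp
  induction h with
  | refl => exact hp
  | tail _ hstep ih => exact hstep.elim (fun h => h.collapse θ ih) fun h => h.collapse θ ih

end Congruence

end PlanarDiagram

end SwingLemma

theorem mainTheorem3 {L : Type*} [Lattice L] [Finite L] [IsUpperModularLattice L]
    (hslim : SwingLemma.IsSlim L) :
    Nonempty (SwingLemma.PlanarDiagram L) ∧
    ∀ (D : SwingLemma.PlanarDiagram L) (p q : SwingLemma.PrimeInterval L),
      (SwingLemma.con p.lo p.hi).r q.lo q.hi ↔
        ∃ (n : ℕ) (r : Fin (n + 1) → SwingLemma.PrimeInterval L),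
          r 0 = p ∧ r (Fin.last n) = q ∧ D.IsSSSequence r := by
  refine ⟨hslim.nonempty_planarDiagram, fun D p q => ?_⟩
  rw [← D.reflTransGen_ssStep_iff]
  exact ⟨D.reflTransGen_ssStep_of_con hslim, SwingLemma.PlanarDiagram.con_of_reflTransGen_ssStep⟩
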